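/- **Letters and words.** Let $\overline{\mathbb Z}$ be the set of letters $i^{(j)}$ with $i\in\mathbb Z$, $j\in\mathbb Z_{\ge1}$, ordered by $i^{(j)}<i'^{(j')}$ iff $i<i'$, or $i=i'$ and $j<j'$; put $\mathrm{val}(i^{(j)})=i$. A word $W=W_1\cdots W_k$ in $\overline{\mathbb Z}$ is *injective* if its letters are pairwise distinct. **Slide polynomials.** For a word $W=W_1\cdots W_k$ let $\mathfrak F(W)=\sum x_{a_1}\cdots x_{a_k}$, the sum over all integer sequences $a_1\ge\dots\ge a_k$ with $1\le a_j\le \mathrm{val}(W_j)$ for all $j$ and $a_j>a_{j+1}$ whenever $W_j>W_{j+1}$. **Divided symmetrization.** For $f\in\mathbb Q[x_1,\dots,x_n]$ homogeneous of degree $n-1$, $$\langle f\rangle_n=\sum_{w\in S_n}w\cdot\left(\frac{f(x_1,\dots,x_n)}{\prod_{1\le i\le n-1}(x_i-x_{i+1})}\right),$$ where $w$ acts by $x_i\mapsto x_{w(i)}$. **The equivalence $\equiv_\Omega$.** An *indexed forest* on a finite set $S\subset\mathbb Z$ (its support) consists of a plane binary tree with $|I|$ nodes for each maximal interval $I$ of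 consecutive integers in $S$ (the support of the tree); the nodes of that tree are identified with the elements of $I$ in inorder. To an injective word $W$ associate an indexed forest $P(W)$ with nodes labeled by letters, as follows. $P$ of the empty word is the empty forest. $P(W'a)$ is obtained from $P(W')$ by adding one node, labeled $a$, at a position $p$: if $\mathrm{val}(a)$ is not in the support of $P(W')$, then $p=\mathrm{val}(a)$; if $\mathrm{val}(a)$ lies in the support $I$ of a tree with root label $r$, then $p=\min I-1$ if $a<r$ and $p=\max I+1$ if $a>r$. The left (right) child of the new node is the root of the tree of $P(W')$ whose support contains $p-1$ (respectively $p+1$), if there is one. Write $W\equiv_\Omega W'$ if $P(W)=P(W')$. A set $A$ of injective words is *$\equiv_\Omega$-stable* if $W\in A$ and $W\equiv_\Omega W'$ imply $W'\in A$, for all injective words $W'$. **$\Omega$-parking words.** To an injective word $W$ associate a set $\Omega(W)\subset\mathbb Z$ with $|W|$ elements, as follows. $\Omega$ of the empty word is $\emptyset$. If $\mathrm{val}(a)\notin\Omega(W')$, then $\Omega(W'a)=\Omega(W')\cup\{\mathrm{val}(a)\}$. Otherwise let $I$ be the maximal interval of $\Omega(W')$ that contains $\mathrm{val}(a)$ and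 let $i$ be the largest index with $\mathrm{val}(W'_i)\in I$; then $\Omega(W'a)=\Omega(W')\cup\{\min I-1\}$ if $a<W'_i$, and $\Omega(W'a)=\Omega(W')\cup\{\max I+1\}$ if $a>W'_i$. The word $W$ is *$\Omega$-parking* if $\Omega(W)=\{1,\dots,|W|\}$. **Theorem.** Let $n\ge1$ and let $A$ be a finite $\equiv_\Omega$-stable set of injective words in $\overline{\mathbb Z}$ of length $n-1$, all of whose letters have values in $\{1,\dots,n\}$. Then $\sum_{W\in A}\mathfrak F(W)$ is a homogeneous polynomial of degree $n-1$ in $x_1,\dots,x_n$, and $$\Big\langle \sum_{W\in A}\mathfrak F(W)\Big\rangle_n=\big|\{W\in A : W\text{ is }\Omega\text{-parking}\}\big|.$$ -/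

import Mathlib

noncomputable section

/-! ### Letters and words

A letter is `i` with exponent `j`, where `i : ℤ` and `j` is a positive integer.  Letters carry the
lexicographic order: first compare the values `i`, then the exponents `j`. -/

abbrev Letter : Type := ℤ ×ₗ ℕ+

/-- The value `i` of the letter with base `i` and exponent `j`. -/
def Letter.val (a : Letter) : ℤ := (ofLex a).1

abbrev Word : Type := List Letter

/-- Injective words: the letters are pairwise distinct. -/
def Word.IsInjective (W : Word) : Prop := W.Nodup

/-! ### Slide polynomials -/

/-- The compatible sequences `(a_1 ≥ ... ≥ a_k)` of a word `W = W_1 ... W_k`: integers with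
`1 ≤ a_j ≤ val (W_j)`, weakly decreasing, with `a_j > a_{j+1}` whenever `W_j > W_{j+1}` in the
order on letters. See `mem_compatible` for the explicit description. -/
def compatible (W : Word) : Finset (Fin W.length → ℤ) :=
  (Fintype.piFinset fun j : Fin W.length => Finset.Icc (1 : ℤ) (W.get j).val).filter fun a =>
    ∀ i j : Fin W.length, i.val + 1 = j.val →
      a j ≤ a i ∧ (W.get j < W.get i → a j < a i)

theorem mem_compatible (W : Word) (a : Fin W.length → ℤ) :
    a ∈ compatible W ↔ (∀ j, 1 ≤ a j ∧ a j ≤ (W.get j).val) ∧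
      ∀ i j : Fin W.length, i.val + 1 = j.val →
        a j ≤ a i ∧ (W.get j < W.get i → a j < a i) := by
  simp [compatible]

/-- The slide polynomial of a word, a polynomial in the variables `x_i`, `i : ℤ`
(in fact, only those with `i ≥ 1` occur). -/
def slide (W : Word) : MvPolynomial ℤ ℚ :=
  ∑ a ∈ compatible W, ∏ j : Fin W.length, MvPolynomial.X (a j)

/-! ### Divided symmetrization

The polynomial ring in `x_1, ..., x_n` is `MvPolynomial (Fin n) ℚ`, where `i : Fin n` is the index
of the variable `x_{i+1}`. -/

/-- The denominator `∏_{1 ≤ i ≤ n-1} (x_i - x_{i+1})`. -/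
def dsDenominator (n : ℕ) : MvPolynomial (Fin n) ℚ :=
  ∏ i : Fin (n - 1),
    (MvPolynomial.X ⟨i.val, by have := i.isLt; omega⟩ -
      MvPolynomial.X ⟨i.val + 1, by have := i.isLt; omega⟩)

/-- The divided symmetrization `∑_{w ∈ S_n} w · (f / ∏_{1 ≤ i ≤ n-1} (x_i - x_{i+1}))`, as an
element of the field of rational functions in `x_1, ..., x_n`. Here `w` acts by `x_i ↦ x_{w i}` on
numerators and denominators. -/
def dividedSymmetrization {n : ℕ} (f : MvPolynomial (Fin n) ℚ) :
    FractionRing (MvPolynomial (Fin n) ℚ) :=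
  ∑ w : Equiv.Perm (Fin n),
    algebraMap (MvPolynomial (Fin n) ℚ) (FractionRing (MvPolynomial (Fin n) ℚ))
        (MvPolynomial.rename w f) /
      algebraMap (MvPolynomial (Fin n) ℚ) (FractionRing (MvPolynomial (Fin n) ℚ))
        (MvPolynomial.rename w (dsDenominator n))

/-! ### Labeled indexed forests and the insertion algorithm -/

/-- A nonempty binary tree with nodes labeled by letters, placed on the interval of integers that
begins at `start` and has as many elements as the tree has nodes. In inorder, the nodes
correspond to the elements of the interval from left to right. -/
structure IndexedTree where
  start : ℤ
  label : Letter
  left : BinaryTree Letter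
  right : BinaryTree Letter

/-- The underlying labeled binary tree. -/
def IndexedTree.toTree (T : IndexedTree) : BinaryTree Letter := .node T.label T.left T.right

/-- The support of an indexed tree, an interval of integers. -/
def IndexedTree.support (T : IndexedTree) : Finset ℤ :=
  Finset.Ico T.start (T.start + T.toTree.numNodes)

/-- A labeled indexed forest is the list of its trees from left to right. (In the forests
constructed below the supports of the trees are the maximal intervals of the total support.) -/
abbrev IndexedForest : Type := List IndexedTree

/-- The tree of the forest whose support contains the integer `i`, if there is one. -/
def IndexedForest.treeAt (F : IndexedForest) (i : ℤ) : Option IndexedTree :=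
  F.find? fun T => decide (i ∈ T.support)

/-- The position, in the support of the new forest, of the node that is created when the letter
`a` is inserted into `F`. It is `val a` if this is not in the support of `F`; otherwise `val a` is
in the support of a tree `T` of `F`, and the position is just to the left or just to the right of
the support of `T`, according as `a` is smaller or larger than the root label of `T`. -/
def IndexedForest.newPos (F : IndexedForest) (a : Letter) : ℤ :=
  match F.treeAt a.val with
  | none => a.val
  | some T => if a < T.label then T.start - 1 else T.start + T.toTree.numNodes

/-- Insertion of the letter `a` into a forest: a new node labeled `a` is created at position
`p = newPos F a`; its left child is the root of the tree of `F` with `p - 1` in its support, its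
right child is the root of the tree of `F` with `p + 1` in its support (no child, if there is no
such tree). The other trees are unchanged. -/
def IndexedForest.insertLetter (F : IndexedForest) (a : Letter) : IndexedForest :=
  let p := F.newPos a
  let u : IndexedTree :=
    { start := (F.treeAt (p - 1)).elim p IndexedTree.start
      label := a
      left := (F.treeAt (p - 1)).elim .nil IndexedTree.toTree
      right := (F.treeAt (p + 1)).elim .nil IndexedTree.toTree }
  (F.filter fun T => decide (p - 1 ∉ T.support ∧ p + 1 ∉ T.support)).orderedInsert
    (fun T T' => T.start ≤ T'.start) u

/-- The P-symbol of a word: the letters are inserted from left to right, starting with the empty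
forest. -/
def pSymbol (W : Word) : IndexedForest := W.foldl IndexedForest.insertLetter []

/-- Two (injective) words are equivalent if they have the same P-symbol. -/
def OmegaEquiv (W W' : Word) : Prop := pSymbol W = pSymbol W'

/-- `A` is a union of classes of the equivalence on injective words. -/
def OmegaStable (A : Finset Word) : Prop :=
  ∀ W ∈ A, ∀ W' : Word, W'.IsInjective → OmegaEquiv W W' → W' ∈ A

/-! ### The parking procedure -/

/-- The maximal interval of consecutive integers in `S` that contains `v`
(meaningful for `v ∈ S`). -/
def block (S : Finset ℤ) (v : ℤ) : Finset ℤ := S.filter fun x => Finset.uIcc x v ⊆ S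

theorem mem_block_self {S : Finset ℤ} {v : ℤ} (h : v ∈ S) : v ∈ block S v := by
  simp [block, h]

/-- The spot where a car with preference `a` parks, if `S` is the set of occupied spots and `V`
lists the preferences of the cars that have already parked, the most recent one first.  If the
spot `val a` is occupied, let `I` be the maximal interval of occupied spots that contains it, and
let `b` be the most recent letter with value in `I`; the car parks in `min I - 1` if `a < b` and
in `max I + 1` if `a > b`.  (Such a letter `b` always exists.) -/
def parkingSpot (S : Finset ℤ) (V : List Letter) (a : Letter) : ℤ :=
  if h : a.val ∈ S then
    match V.find? fun b => decide (b.val ∈ block S a.val) with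
    | some b =>
      if a < b then (block S a.val).min' ⟨_, mem_block_self h⟩ - 1
      else (block S a.val).max' ⟨_, mem_block_self h⟩ + 1
    | none => (block S a.val).max' ⟨_, mem_block_self h⟩ + 1
  else a.val

/-- The set of occupied spots, for the word given in reverse (last letter first). -/
def omegaRev : List Letter → Finset ℤ
  | [] => ∅
  | a :: V => insert (parkingSpot (omegaRev V) V a) (omegaRev V)

/-- The set of spots that are occupied once all the cars with preferences `W_1, W_2, ...` have
parked, in this order. -/
def omega (W : Word) : Finset ℤ := omegaRev W.reverse

theorem omega_nil : omega [] = ∅ := rfl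

theorem omega_concat (W : Word) (a : Letter) :
    omega (W ++ [a]) = insert (parkingSpot (omega W) W.reverse a) (omega W) := by
  simp [omega, omegaRev]

/-- A parking word: the occupied spots are `1, ..., k`, where `k` is the length of the word. -/
def IsOmegaParking (W : Word) : Prop := omega W = Finset.Icc (1 : ℤ) W.length

instance decidableIsOmegaParking : DecidablePred IsOmegaParking := fun W =>
  inferInstanceAs (Decidable (omega W = Finset.Icc (1 : ℤ) W.length))

end

/-!
The proof combines a product formula for the sum of slide polynomials over one class with a
recursion for divided symmetrization that deletes leaves from forests.

**Classes and forests.** The P-symbol `F` of an injective word is well formed (`ForestWF`): the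
value of each label lies in the support of the subtree below it, left children have smaller and
right children larger labels than their parents. Conversely the words with P-symbol `F` are the
linear extensions of `F`: their last letter is the label of a root, and inserting it restores `F`
(`insertLetter_children`, `exists_insertLetter_eq`). The parking procedure fills the support of `F`
(`omega_eq_support`), so being a parking word depends only on the class, and the number of words in
the class is given by the hook length formula (`card_forestWords`).

**Sums of slide polynomials.** Compatible sequences are increasing sequences of pairs of an integer
and a letter. As in the theory of P-partitions, summing over the linear extensions of `F` gives the
generating function of all labelings of the nodes that satisfy the inequalities along the edges of
`F` (`sum_chainSum_forestWords`). By well-formedness the bounds by values of letters may be replaced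
by bounds by positions (`labelSum_eq_treeSum`), and the result is the forest polynomial `forestSum`.

**Divided symmetrization.** For a form `f` of degree `n - 1` in `n` variables it is a constant
(`exists_listSymm_eval_eq`), so one variable may be set to zero. Partial fractions
(`sum_insertions_div_consecDiff`) then give `⟨f⟩_n = ∑_{i < n} ⟨T_i f⟩_{n-1}` for the trimming
operators `T_i f = (f (..., x_i, 0, x_{i+1}, ...) - f (..., 0, x_i, x_{i+1}, ...)) / x_i`. Applied to
a forest polynomial, `T_i` deletes the node at position `i` if it is a leaf, and gives zero otherwise
(`treeSum_insertZero_succ`, `forestSum_insertZero_succ`). Hence for a tree with support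
`1, ..., n - 1` the divided symmetrization counts linear extensions (`listSymm_treeSum`); a node at a
position beyond `n - 1` can never be deleted, which makes it vanish for the other forests
(`listSymm_forestSum_of_protrudes`).
-/

/-! ### Divided symmetrization of functions on lists -/

section DividedSymmetrization

variable {K : Type*} [Field K]

/-- The product of the differences of consecutive entries of a list. -/
def consecDiff : List K → K
  | [] => 1
  | [_] => 1
  | a :: b :: l => (a - b) * consecDiff (b :: l)

/-- Divided symmetrization of a function `f` of several arguments, given as a function on lists:
the sum of `f m / consecDiff m` over all rearrangements `m` of `l`. -/
def listSymm (f : List K → K) (l : List K) : K :=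
  (l.permutations'.map fun m => f m / consecDiff m).sum

theorem consecDiff_ne_zero {l : List K} (hl : l.Nodup) : consecDiff l ≠ 0 := by
  induction l with
  | nil => simp [consecDiff]
  | cons a l ih =>
    cases l with
    | nil => simp [consecDiff]
    | cons b l =>
      simp only [consecDiff]
      refine mul_ne_zero (sub_ne_zero.2 ?_) (ih hl.of_cons)
      rintro rfl
      simp at hl

/-- Summing over all insertions of `z` into `m` replaces `f` by a sum of divided differences: the
partial fractions `(x - y) / ((x - z) (z - y)) = 1 / (x - z) + 1 / (z - y)` telescope. -/
theorem sum_insertions_div_consecDiff (z : K) (f : List K → K) (m : List K) (hne : m ≠ [])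
    (hm : m.Nodup) (hz : z ∉ m) :
    ((m.permutations'Aux z).map fun m' => f m' / consecDiff m').sum =
      (∑ i ∈ Finset.range m.length,
        (f (m.insertIdx (i + 1) z) - f (m.insertIdx i z)) / (m.getD i 0 - z)) / consecDiff m := by
  induction m generalizing f with
  | nil => exact absurd rfl hne
  | cons y ys ih =>
    have hyz : y - z ≠ 0 := sub_ne_zero.2 fun h => hz (by simp [h])
    have hzy : z - y ≠ 0 := sub_ne_zero.2 fun h => hz (by simp [h])
    cases ys with
    | nil =>
      simp [consecDiff]
      field_simp
      ring
    | cons y2 ys =>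
      have hyy : y - y2 ≠ 0 := sub_ne_zero.2 fun h => by simp [h] at hm
      have hzy2 : z - y2 ≠ 0 := sub_ne_zero.2 fun h => hz (by simp [h])
      have hd : consecDiff (y2 :: ys) ≠ 0 := consecDiff_ne_zero hm.of_cons
      have key := ih (fun l => f (y :: l)) (by simp) hm.of_cons (fun h => hz (by simp [h]))
      rw [List.length_cons, Finset.sum_range_succ']
      simp only [List.permutations'Aux, List.map_cons, List.map_map, List.sum_cons,
        Function.comp_def, consecDiff, List.insertIdx_succ_cons, List.insertIdx_zero,
        List.getD_cons_succ, List.getD_cons_zero] at key ⊢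
      have hr : (List.map (fun x => f (y :: y2 :: x) / ((y - y2) * consecDiff (y2 :: x)))
          (List.permutations'Aux z ys)).sum = (y - y2)⁻¹ *
          (List.map (fun x => f (y :: y2 :: x) / consecDiff (y2 :: x))
          (List.permutations'Aux z ys)).sum := by
        rw [← List.sum_map_mul_left]
        refine congrArg List.sum (List.map_congr_left fun x _ => ?_)
        rw [div_mul_eq_div_div_swap, div_eq_inv_mul _ (y - y2)]
      rw [hr, eq_sub_of_add_eq' key, add_div]
      simp only [List.length_cons]
      generalize (∑ x ∈ Finset.range (ys.length + 1), _ : K) = S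
      field_simp
      ring

/-- The divided difference of a monomial in two variables is, up to sign, a sum of monomials. -/
theorem exists_monomial_sub_swap (p q : ℕ) : ∃ (ε : K) (s : Finset ℕ), (∀ k ∈ s, k < p + q) ∧
    ∀ a b : K, a ^ p * b ^ q - a ^ q * b ^ p =
      (a - b) * (ε * ∑ k ∈ s, b ^ k * a ^ (p + q - 1 - k)) := by
  have main : ∀ q d : ℕ, ∀ a b : K, a ^ (q + d) * b ^ q - a ^ q * b ^ (q + d) =
      (a - b) * ∑ k ∈ Finset.Ico q (q + d), b ^ k * a ^ (q + d + q - 1 - k) := by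
    intro q d a b
    rw [Finset.sum_Ico_eq_sum_range, Nat.add_sub_cancel_left]
    have h := (Commute.all a b).mul_geom_sum₂ d
    rw [← Finset.sum_range_reflect] at h
    have : ∑ k ∈ Finset.range d, b ^ (q + k) * a ^ (q + d + q - 1 - (q + k)) =
        a ^ q * b ^ q * ∑ j ∈ Finset.range d, a ^ (d - 1 - j) * b ^ (d - 1 - (d - 1 - j)) := by
      rw [Finset.mul_sum]
      refine Finset.sum_congr rfl fun k hk => ?_
      have hk := Finset.mem_range.1 hk
      rw [show q + d + q - 1 - (q + k) = q + (d - 1 - k) by omega,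
        show d - 1 - (d - 1 - k) = k by omega, pow_add, pow_add]
      ring
    rw [this, mul_left_comm, h]
    ring
  rcases le_total q p with h | h
  · obtain ⟨d, rfl⟩ := Nat.exists_eq_add_of_le h
    refine ⟨1, Finset.Ico q (q + d), fun k hk => ?_, fun a b => ?_⟩
    · have := (Finset.mem_Ico.1 hk).2
      omega
    · rw [main, one_mul]
  · obtain ⟨d, rfl⟩ := Nat.exists_eq_add_of_le h
    refine ⟨-1, Finset.Ico p (p + d), fun k hk => ?_, fun a b => ?_⟩
    · have := (Finset.mem_Ico.1 hk).2
      omega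
    · rw [add_comm p (p + d), neg_one_mul, mul_neg, ← main, neg_sub]

/-- The monomial with exponents `c 0, c 1, ...` as a function of a list. -/
def listMonomial (c : ℕ → ℕ) (l : List K) : K :=
  ∏ i ∈ Finset.range l.length, l.getD i 0 ^ c i

theorem listMonomial_cons (c : ℕ → ℕ) (a : K) (l : List K) :
    listMonomial c (a :: l) = a ^ c 0 * listMonomial (fun j => c (j + 1)) l := by
  simp [listMonomial, Finset.prod_range_succ', mul_comm]

/-- The exponents obtained from `c` when the entries at `i` and `i + 1` are merged into the single
entry `a`. -/
def mergeExp (c : ℕ → ℕ) (i a : ℕ) (j : ℕ) : ℕ :=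
  if j < i then c j else if j = i then a else c (j + 1)

theorem sum_mergeExp (c : ℕ → ℕ) (i a n : ℕ) (hi : i < n) :
    ∑ j ∈ Finset.range n, mergeExp c i a j + (c i + c (i + 1)) =
      ∑ j ∈ Finset.range (n + 1), c j + a := by
  induction n generalizing c i with
  | zero => omega
  | succ n ih =>
    cases i with
    | zero =>
      rw [Finset.sum_range_succ', Finset.sum_range_succ', Finset.sum_range_succ']
      simp [mergeExp]
      omega
    | succ i =>
      have := ih (fun j => c (j + 1)) i (by omega)
      rw [Finset.sum_range_succ', Finset.sum_range_succ']
      simp only [mergeExp, add_lt_add_iff_right, add_left_inj] at this ⊢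
      simp only [Nat.zero_lt_succ, if_true]
      omega

theorem listMonomial_insertIdx_sub {c : ℕ → ℕ} {i : ℕ} {ε : K} {s : Finset ℕ}
    (hε : ∀ a b : K, a ^ c i * b ^ c (i + 1) - a ^ c (i + 1) * b ^ c i =
      (a - b) * (ε * ∑ k ∈ s, b ^ k * a ^ (c i + c (i + 1) - 1 - k)))
    (z : K) (m : List K) (hi : i < m.length) :
    listMonomial c (m.insertIdx (i + 1) z) - listMonomial c (m.insertIdx i z) =
      (m.getD i 0 - z) * (ε * ∑ k ∈ s, z ^ k *
        listMonomial (mergeExp c i (c i + c (i + 1) - 1 - k)) m) := by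
  induction m generalizing c i with
  | nil => simp at hi
  | cons a m ih =>
    cases i with
    | zero =>
      simp only [List.insertIdx_succ_cons, List.insertIdx_zero, listMonomial_cons,
        List.getD_cons_zero, mergeExp]
      have h : ∀ k, z ^ k * (a ^ (c 0 + c 1 - 1 - k) * listMonomial (fun j => c (j + 1 + 1)) m) =
        z ^ k * a ^ (c 0 + c 1 - 1 - k) * listMonomial (fun j => c (j + 1 + 1)) m :=
          fun k => by ring
      simp only [lt_irrefl, if_true, if_false, Nat.not_lt_zero, Nat.succ_ne_zero, zero_add, h,
        ← Finset.sum_mul]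
      have := hε a z
      rw [zero_add] at this
      linear_combination listMonomial (fun j => c (j + 1 + 1)) m * this
    | succ i =>
      have := ih (c := fun j => c (j + 1)) (i := i) hε (by simpa using hi)
      have h : ∀ b, (fun j => mergeExp c (i + 1) b (j + 1)) = mergeExp (fun j => c (j + 1)) i b := by
        intro b
        funext j
        simp [mergeExp]
      simp only [List.insertIdx_succ_cons, listMonomial_cons, List.getD_cons_succ, h] at this ⊢
      rw [← mul_sub, this]
      simp only [mergeExp, Nat.zero_lt_succ, if_true, Finset.mul_sum]
      exact Finset.sum_congr rfl fun k _ => by ring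

theorem listSymm_cons (f : List K → K) (z : K) (m : List K) (hne : m ≠ []) (hm : (z :: m).Nodup) :
    listSymm f (z :: m) = listSymm (fun m => ∑ i ∈ Finset.range m.length,
        (f (m.insertIdx (i + 1) z) - f (m.insertIdx i z)) / (m.getD i 0 - z)) m := by
  rw [listSymm, List.permutations', List.map_flatMap, List.flatMap_def, List.sum_flatten,
    List.map_map, listSymm]
  refine congrArg List.sum (List.map_congr_left fun m' hm' => ?_)
  have hp := List.mem_permutations'.1 hm'
  have hnd := List.nodup_cons.1 hm
  refine sum_insertions_div_consecDiff z f m' ?_ (hp.nodup_iff.2 hnd.2) ?_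
  · rintro rfl
    exact hne hp.symm.eq_nil
  · exact fun h => hnd.1 (hp.mem_iff.1 h)

theorem listSymm_congr {f g : List K → K} {l : List K} (h : ∀ m, m.Perm l → f m = g m) :
    listSymm f l = listSymm g l :=
  congrArg List.sum (List.map_congr_left fun m hm => by rw [h m (List.mem_permutations'.1 hm)])

theorem listSymm_sum {ι : Type*} (s : Finset ι) (f : ι → List K → K) (l : List K) :
    listSymm (fun m => ∑ i ∈ s, f i m) l = ∑ i ∈ s, listSymm (f i) l := by
  classical
  induction s using Finset.induction_on with
  | empty => simp [listSymm]
  | insert a s ha ih =>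
    rw [Finset.sum_insert ha, ← ih]
    simp [listSymm, Finset.sum_insert ha, add_div, List.sum_map_add]

theorem listSymm_const_mul (a : K) (f : List K → K) (l : List K) :
    listSymm (fun m => a * f m) l = a * listSymm f l := by
  simp [listSymm, mul_div_assoc, List.sum_map_mul_left]

/-- Divided symmetrization in `n + 1` variables turns monomials of degree at most `n` into
constants, and those of degree less than `n` into zero. Singling out one variable `z` expresses it
through divided symmetrizations in `n` variables of monomials `z ^ k * x ^ c'`, where `x ^ c'` has
degree at most `n - 1 - k`; by induction only the terms with `k = 0` survive. -/
theorem exists_listSymm_listMonomial_eq (n : ℕ) (c : ℕ → ℕ) : ∃ C : K,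
    (∑ i ∈ Finset.range (n + 1), c i < n → C = 0) ∧
    (∑ i ∈ Finset.range (n + 1), c i ≤ n → ∀ l : List K, l.Nodup → l.length = n + 1 →
      listSymm (listMonomial c) l = C) := by
  induction n generalizing c with
  | zero =>
    refine ⟨1, fun h => absurd h (Nat.not_lt_zero _), fun h l _ hlen => ?_⟩
    obtain ⟨x, rfl⟩ := List.length_eq_one_iff.1 hlen
    have : c 0 = 0 := by simpa using h
    simp [listSymm, listMonomial, consecDiff, this]
  | succ n ih =>
    choose C hC0 hC using ih
    choose ε s hs hε using fun p q => exists_monomial_sub_swap (K := K) p q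
    refine ⟨∑ i ∈ Finset.range (n + 1), ε (c i) (c (i + 1)) * ∑ k ∈ s (c i) (c (i + 1)),
      if k = 0 then C (mergeExp c i (c i + c (i + 1) - 1)) else 0, fun h => ?_, fun h l hl hlen => ?_⟩
    · refine Finset.sum_eq_zero fun i hi => ?_
      rw [Finset.sum_eq_zero, mul_zero]
      intro k hk
      have h1 := sum_mergeExp c i (c i + c (i + 1) - 1) (n + 1) (Finset.mem_range.1 hi)
      have h2 := hs _ _ k hk
      split_ifs
      · exact hC0 _ (by omega)
      · rfl
    · obtain ⟨z, m, rfl⟩ : ∃ z m, l = z :: m := by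
        cases l with
        | nil => simp at hlen
        | cons z m => exact ⟨z, m, rfl⟩
      have hm : m.length = n + 1 := by simpa using hlen
      have hnd := List.nodup_cons.1 hl
      rw [listSymm_cons _ z m (by rintro rfl; simp at hm) hl]
      have key : listSymm (fun m' => ∑ i ∈ Finset.range (n + 1), ε (c i) (c (i + 1)) *
          ∑ k ∈ s (c i) (c (i + 1)), z ^ k *
            listMonomial (mergeExp c i (c i + c (i + 1) - 1 - k)) m') m =
          ∑ i ∈ Finset.range (n + 1), ε (c i) (c (i + 1)) * ∑ k ∈ s (c i) (c (i + 1)),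
          z ^ k * listSymm (listMonomial (mergeExp c i (c i + c (i + 1) - 1 - k))) m := by
        simp only [listSymm_sum, listSymm_const_mul]
      rw [listSymm_congr (g := fun m' => ∑ i ∈ Finset.range (n + 1), ε (c i) (c (i + 1)) *
        ∑ k ∈ s (c i) (c (i + 1)), z ^ k *
          listMonomial (mergeExp c i (c i + c (i + 1) - 1 - k)) m'), key]
      · refine Finset.sum_congr rfl fun i hi => congrArg _ (Finset.sum_congr rfl fun k hk => ?_)
        have h1 := sum_mergeExp c i (c i + c (i + 1) - 1 - k) (n + 1) (Finset.mem_range.1 hi)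
        have h2 := hs _ _ k hk
        rw [hC _ (by omega) m hnd.2 hm]
        split_ifs with hk0
        · simp [hk0]
        · rw [hC0 _ (by omega), mul_zero]
      · intro m' hm'
        rw [hm'.length_eq, hm]
        refine Finset.sum_congr rfl fun i hi => ?_
        have hi' : i < m'.length := by
          rw [hm'.length_eq, hm]
          exact Finset.mem_range.1 hi
        rw [listMonomial_insertIdx_sub (hε _ _) z m' hi', mul_div_cancel_left₀]
        refine sub_ne_zero.2 fun hz => hnd.1 (hm'.mem_iff.1 ?_)
        rw [← hz, List.getD_eq_getElem _ _ hi']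
        exact List.getElem_mem hi'

/-- The values of the variables `x_1, x_2, ...` listed in `l`; all other variables are zero. -/
def listVal (l : List K) (j : ℤ) : K := if 1 ≤ j then l.getD (j - 1).toNat 0 else 0

theorem listVal_succ (l : List K) (j : ℕ) : listVal l (j + 1) = l.getD j 0 := by
  simp [listVal]

theorem listVal_eq_zero {l : List K} {j : ℤ} (h : ¬ (1 ≤ j ∧ j ≤ l.length)) : listVal l j = 0 := by
  unfold listVal
  split_ifs with h1
  · exact List.getD_eq_default _ _ (by omega)
  · rfl

/-- The divided symmetrization in `n + 1` variables of a form of degree `n` is a constant. -/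
theorem exists_listSymm_eval_eq (n : ℕ) (p : MvPolynomial ℤ K) (hp : p.IsHomogeneous n) :
    ∃ C : K, ∀ l : List K, l.Nodup → l.length = n + 1 →
      listSymm (fun m => MvPolynomial.eval (listVal m) p) l = C := by
  choose C _ hC using fun c => exists_listSymm_listMonomial_eq (K := K) n c
  refine ⟨∑ d ∈ p.support, p.coeff d * if d.support ⊆ Finset.Icc 1 (n + 1 : ℤ) then
    C fun j => d (j + 1) else 0, fun l hl hlen => ?_⟩
  have h1 : (fun m : List K => MvPolynomial.eval (listVal m) p) = fun m =>
      ∑ d ∈ p.support, p.coeff d * ∏ i ∈ d.support, listVal m i ^ d i :=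
    funext fun m => MvPolynomial.eval_eq _ _
  rw [h1, listSymm_sum]
  simp only [listSymm_const_mul]
  refine Finset.sum_congr rfl fun d hd => congrArg _ ?_
  have himg : (Finset.range (n + 1)).image (fun j : ℕ => (j : ℤ) + 1) = Finset.Icc 1 (n + 1 : ℤ) := by
    ext x
    simp only [Finset.mem_image, Finset.mem_range, Finset.mem_Icc]
    constructor
    · rintro ⟨j, hj, rfl⟩
      omega
    · intro h
      exact ⟨(x - 1).toNat, by omega, by omega⟩
  have hinj : Set.InjOn (fun j : ℕ => (j : ℤ) + 1) (Finset.range (n + 1)) := by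
    intro a _ b _ h
    simpa using h
  split_ifs with hs
  · rw [← hC (fun j => d (j + 1)) (le_of_eq ?_) l hl hlen]
    · refine listSymm_congr fun m hm => ?_
      rw [Finset.prod_subset hs, ← himg, Finset.prod_image hinj, listMonomial, hm.length_eq, hlen]
      · simp only [listVal_succ]
      · intro x _ hx
        rw [Finsupp.notMem_support_iff.1 hx, pow_zero]
    · have hdeg := hp (MvPolynomial.mem_support_iff.1 hd)
      rw [Finsupp.weight_apply, Finsupp.sum, Finset.sum_subset hs, ← himg,
        Finset.sum_image hinj] at hdeg
      · simpa using hdeg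
      · intro x _ hx
        simp [Finsupp.notMem_support_iff.1 hx]
  · obtain ⟨x, hx, hx'⟩ := Finset.not_subset.1 hs
    rw [listSymm_congr (g := fun _ => 0 * 0), listSymm_const_mul, zero_mul]
    intro m hm
    rw [zero_mul]
    refine Finset.prod_eq_zero hx ?_
    rw [listVal_eq_zero, zero_pow (Finsupp.mem_support_iff.1 hx)]
    rw [hm.length_eq, hlen]
    simpa using hx'

/-- Since the divided symmetrization of a form of degree `n` in `n + 1` variables is constant, it
can be computed with one variable equal to zero. -/
theorem exists_listSymm_eval_eq_sum [CharZero K] (n : ℕ) : ∃ l₀ : List K, l₀.Nodup ∧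
    l₀.length = n + 1 ∧ ∀ (p : MvPolynomial ℤ K) (_ : p.IsHomogeneous (n + 1))
      (g : ℕ → List K → K) (_ : ∀ m : List K, m.length = n + 1 → ∀ i < n + 1,
        MvPolynomial.eval (listVal (m.insertIdx (i + 1) 0)) p -
        MvPolynomial.eval (listVal (m.insertIdx i 0)) p = m.getD i 0 * g i m)
      (l : List K), l.Nodup → l.length = n + 2 →
      listSymm (fun m => MvPolynomial.eval (listVal m) p) l =
        ∑ i ∈ Finset.range (n + 1), listSymm (g i) l₀ := by
  let l₀ : List K := (List.range (n + 1)).map fun i : ℕ => (i : K) + 1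
  have h0 : (0 : K) ∉ l₀ := by
    simp only [l₀, List.mem_map, not_exists, not_and]
    intro i _ h
    exact Nat.cast_add_one_ne_zero i h
  have hnd : l₀.Nodup := by
    refine List.Nodup.map ?_ List.nodup_range
    intro a b h
    simpa using h
  refine ⟨l₀, hnd, by simp [l₀], fun p hp g hg l hl hlen => ?_⟩
  obtain ⟨C, hC⟩ := exists_listSymm_eval_eq (n + 1) p hp
  have hnd' : (0 :: l₀).Nodup := List.nodup_cons.2 ⟨h0, hnd⟩
  rw [hC l hl hlen, ← hC (0 :: l₀) hnd' (by simp [l₀]), listSymm_cons _ _ _ (by simp [l₀]) hnd',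
    ← listSymm_sum]
  refine listSymm_congr fun m hm => ?_
  have hlm : m.length = n + 1 := by rw [hm.length_eq]; simp [l₀]
  rw [hlm]
  refine Finset.sum_congr rfl fun i hi => ?_
  have hi := Finset.mem_range.1 hi
  rw [hg m hlm i hi, sub_zero, mul_div_cancel_left₀]
  intro h
  refine h0 (hm.mem_iff.1 ?_)
  rw [← h, List.getD_eq_getElem _ _ (by omega)]
  exact List.getElem_mem _

end DividedSymmetrization

/-! ### Forest polynomials -/

noncomputable section ForestPolynomials

variable {α R S : Type*} [CommRing R] [CommRing S]

/-- The forest polynomial of a binary tree whose nodes are placed in inorder at the integers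
`s, s + 1, ...`, evaluated at `y`. It sums the products of the `y (f v)` over all labelings `f` of
the nodes by integers such that the root has label at least `t`, the label of a left child is at
least, and that of a right child greater than, the label of its parent, and the label of a node
is at most the first position in its subtree. -/
def treeSum (y : ℤ → R) : BinaryTree α → ℤ → ℤ → R
  | .nil, _, _ => 1
  | .node _ l r, s, t => ∑ u ∈ Finset.Icc t s,
      y u * (treeSum y l s u * treeSum y r (s + l.numNodes + 1) (u + 1))

theorem map_treeSum (φ : R →+* S) (y : ℤ → R) (T : BinaryTree α) (s t : ℤ) :
    φ (treeSum y T s t) = treeSum (fun j => φ (y j)) T s t := by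
  induction T generalizing s t with
  | nil => simp [treeSum]
  | node a l r ihl ihr => simp [treeSum, ihl, ihr]

theorem isHomogeneous_treeSum (T : BinaryTree α) (s t : ℤ) :
    (treeSum (MvPolynomial.X : ℤ → MvPolynomial ℤ R) T s t).IsHomogeneous T.numNodes := by
  induction T generalizing s t with
  | nil => exact MvPolynomial.isHomogeneous_one _ _
  | node a l r ihl ihr =>
    refine MvPolynomial.IsHomogeneous.sum _ _ _ fun u _ => ?_
    have := (MvPolynomial.isHomogeneous_X R u).mul ((ihl s u).mul (ihr (s + l.numNodes + 1) (u + 1)))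
    rwa [add_comm 1] at this

theorem treeSum_eq_zero (y : ℤ → R) {T : BinaryTree α} (hT : T ≠ .nil) {s t : ℤ} (h : s < t) :
    treeSum y T s t = 0 := by
  cases T with
  | nil => exact absurd rfl hT
  | node a l r => rw [treeSum, Finset.Icc_eq_empty (by omega), Finset.sum_empty]

theorem treeSum_congr {y y' : ℤ → R} (T : BinaryTree α) (s t : ℤ)
    (h : ∀ j < s + T.numNodes, y j = y' j) : treeSum y T s t = treeSum y' T s t := by
  induction T generalizing s t with
  | nil => rfl
  | node a l r ihl ihr =>
    simp only [BinaryTree.numNodes] at h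
    push_cast at h
    refine Finset.sum_congr rfl fun u hu => ?_
    have := (Finset.mem_Icc.1 hu).2
    rw [h u (by omega), ihl _ _ fun j hj => h j (by omega), ihr _ _ fun j hj => h j (by omega)]

/-- The sequence `y` with an additional zero at the index `i`. Substituting it for the variables
of a polynomial sets `x_i` to zero and lowers the indices of the later variables. -/
def insertZero (i : ℤ) (y : ℤ → R) (j : ℤ) : R :=
  if j < i then y j else if j = i then 0 else y (j - 1)

theorem insertZero_of_lt {i j : ℤ} (h : j < i) (y : ℤ → R) : insertZero i y j = y j := if_pos h

theorem insertZero_self (i : ℤ) (y : ℤ → R) : insertZero i y i = 0 := by simp [insertZero]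

theorem insertZero_of_gt {i j : ℤ} (h : i < j) (y : ℤ → R) : insertZero i y j = y (j - 1) := by
  simp [insertZero, h.not_gt, h.ne']

theorem sum_insertZero_mul (y F : ℤ → R) {i s : ℤ} (t : ℤ) (h : i ≤ s) :
    ∑ u ∈ Finset.Icc t s, insertZero i y u * F u =
      ∑ u ∈ Finset.Icc (if t ≤ i then t else t - 1) (s - 1),
        y u * F (if u < i then u else u + 1) := by
  rw [← Finset.sum_filter_of_ne (p := fun u => u ≠ i)]
  · refine Finset.sum_bij' (fun u _ => if u < i then u else u - 1)
      (fun u _ => if u < i then u else u + 1) ?_ ?_ ?_ ?_ ?_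
    · intro u hu
      simp only [Finset.mem_filter, Finset.mem_Icc] at hu ⊢
      split_ifs <;> omega
    · intro u hu
      simp only [Finset.mem_filter, Finset.mem_Icc] at hu ⊢
      split_ifs at hu ⊢ <;> omega
    · intro u hu
      simp only [Finset.mem_filter, Finset.mem_Icc] at hu
      split_ifs <;> omega
    · intro u hu
      simp only [Finset.mem_Icc] at hu
      split_ifs <;> omega
    · intro u hu
      simp only [Finset.mem_filter, Finset.mem_Icc] at hu
      by_cases hui : u < i
      · simp [hui, insertZero_of_lt]
      · rw [insertZero_of_gt (by omega), if_neg hui, if_neg (by omega), sub_add_cancel]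
  · rintro u _ hu rfl
    exact hu (by rw [insertZero_self, zero_mul])

/-- Setting a variable to zero shifts the trees that lie to its right. -/
theorem treeSum_insertZero_of_le (y : ℤ → R) (T : BinaryTree α) {i s : ℤ} (t : ℤ) (h : i ≤ s) :
    treeSum (insertZero i y) T s t = treeSum y T (s - 1) (if t ≤ i then t else t - 1) := by
  induction T generalizing s t with
  | nil => rfl
  | node a l r ihl ihr =>
    simp only [treeSum]
    rw [sum_insertZero_mul y _ t h]
    refine Finset.sum_congr rfl fun u _ => ?_
    rw [ihl _ h, ihr _ (by omega), show s + l.numNodes + 1 - 1 = s - 1 + l.numNodes + 1 by ring]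
    congr 3 <;> split_ifs <;> omega

/-- Setting a variable to zero does not affect the trees that lie to its left. -/
theorem treeSum_insertZero_of_ge (y : ℤ → R) (T : BinaryTree α) {i s : ℤ} (t : ℤ)
    (h : s + T.numNodes ≤ i) : treeSum (insertZero i y) T s t = treeSum y T s t :=
  treeSum_congr _ _ _ fun _ hj => insertZero_of_lt (by omega) _

/-- The tree obtained by deleting the `k`-th node in inorder (counted from `0`), provided that it
is a leaf. -/
def deleteLeaf : BinaryTree α → ℕ → Option (BinaryTree α)
  | .nil, _ => none
  | .node a l r, k =>
    if k < l.numNodes then (deleteLeaf l k).map fun l' => .node a l' r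
    else if k = l.numNodes then
      if l.numNodes + r.numNodes = 0 then some .nil else none
    else (deleteLeaf r (k - l.numNodes - 1)).map fun r' => .node a l r'

theorem eq_nil_of_numNodes_eq_zero {T : BinaryTree α} (h : T.numNodes = 0) : T = .nil := by
  cases T with
  | nil => rfl
  | node a l r => simp [BinaryTree.numNodes] at h

theorem numNodes_deleteLeaf {T T' : BinaryTree α} {k : ℕ} (h : deleteLeaf T k = some T') :
    T'.numNodes + 1 = T.numNodes := by
  induction T generalizing T' k with
  | nil => simp [deleteLeaf] at h
  | node a l r ihl ihr =>
    rw [deleteLeaf] at h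
    split_ifs at h with h1 h2 h3
    · obtain ⟨l', hl', rfl⟩ := Option.map_eq_some_iff.1 h
      have := ihl hl'
      simp only [BinaryTree.numNodes]
      omega
    · cases h
      simp [BinaryTree.numNodes, h3]
    · obtain ⟨r', hr', rfl⟩ := Option.map_eq_some_iff.1 h
      have := ihr hr'
      simp only [BinaryTree.numNodes]
      omega

/-- The trimming operator `(f (..., x_{i-1}, x_i, 0, x_{i+1}, ...) -
f (..., x_{i-1}, 0, x_i, x_{i+1}, ...)) / x_i` applied to the forest polynomial of a tree yields
the forest polynomial of the tree without the node at position `i` if that node is a leaf, and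
zero otherwise. -/
theorem treeSum_insertZero_succ (y : ℤ → R) (T : BinaryTree α) (s t : ℤ) {k : ℕ}
    (hk : k < T.numNodes) (ht : t ≤ s + k) :
    treeSum (insertZero (s + k + 1) y) T s t = treeSum (insertZero (s + k) y) T s t +
      y (s + k) * (deleteLeaf T k).elim 0 fun T' => treeSum y T' s t := by
  induction T generalizing s t k with
  | nil => simp [BinaryTree.numNodes] at hk
  | node a l r ihl ihr =>
    simp only [BinaryTree.numNodes] at hk
    rw [deleteLeaf]
    split_ifs with h1 h2 h3
    · have hE : ((deleteLeaf l k).map fun l' => BinaryTree.node a l' r).elim 0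
          (fun T' => treeSum y T' s t) = ∑ u ∈ Finset.Icc t s, y u *
            ((deleteLeaf l k).elim 0 (fun l' => treeSum y l' s u) *
              treeSum y r (s + l.numNodes) (u + 1)) := by
        cases hd : deleteLeaf l k with
        | none => simp
        | some l' =>
          have := numNodes_deleteLeaf hd
          simp only [Option.map_some, Option.elim_some, treeSum]
          rw [← this]
          push_cast
          simp only [add_assoc]
      rw [hE, treeSum, treeSum, Finset.mul_sum, ← Finset.sum_add_distrib]
      refine Finset.sum_congr rfl fun u hu => ?_
      have hus := (Finset.mem_Icc.1 hu).2
      rw [ihl s u h1 (by omega), treeSum_insertZero_of_le y r _ (by omega),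
        treeSum_insertZero_of_le y r _ (by omega), if_pos (by omega),
        insertZero_of_lt (by omega)]
      rcases (show u ≤ s + k by omega).lt_or_eq with h | h
      · rw [insertZero_of_lt h, if_pos (by omega), add_sub_cancel_right]
        ring
      · -- Here `u = s = s + k`, and the only label left for the root of `l` is the zero variable.
        have hk0 : k = 0 := by omega
        have hl : l ≠ .nil := by
          rintro rfl
          simp [BinaryTree.numNodes] at h1
        have hz : treeSum (insertZero (s + k) y) l s u = 0 := by
          obtain ⟨b, l1, l2, rfl⟩ : ∃ b l1 l2, l = .node b l1 l2 := by
            cases l with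
            | nil => exact absurd rfl hl
            | node b l1 l2 => exact ⟨b, l1, l2, rfl⟩
          rw [treeSum]
          refine Finset.sum_eq_zero fun v hv => ?_
          have hv := Finset.mem_Icc.1 hv
          rw [show v = s + k by omega, insertZero_self, zero_mul]
        rw [hz, add_sub_cancel_right]
        ring
    · subst h2
      obtain rfl : l = .nil := eq_nil_of_numNodes_eq_zero (by omega)
      obtain rfl : r = .nil := eq_nil_of_numNodes_eq_zero (by omega)
      have hts : t ≤ s := by simpa [BinaryTree.numNodes] using ht
      simp only [treeSum, mul_one, Option.elim_some, BinaryTree.numNodes, Nat.cast_zero, add_zero]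
      rw [← Finset.Ico_insert_right hts, Finset.sum_insert (by simp), Finset.sum_insert (by simp),
        insertZero_self, insertZero_of_lt (by omega), zero_add, add_comm]
      congr 1
      refine Finset.sum_congr rfl fun u hu => ?_
      have hu := Finset.mem_Ico.1 hu
      rw [insertZero_of_lt (by omega), insertZero_of_lt (by omega)]
    · subst h2
      simp only [treeSum, Option.elim_none, mul_zero, add_zero]
      refine Finset.sum_congr rfl fun u hu => ?_
      have hu := Finset.mem_Icc.1 hu
      rw [treeSum_insertZero_of_ge y l _ (by omega), treeSum_insertZero_of_ge y l _ le_rfl,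
        treeSum_insertZero_of_le y r _ le_rfl, treeSum_insertZero_of_le y r _ (by omega),
        if_pos (by omega), insertZero_of_lt (by omega)]
      rcases (show u ≤ s + l.numNodes by omega).lt_or_eq with h | h
      · rw [insertZero_of_lt h, if_pos (by omega)]
      · -- The label `u` equals `s`; then the left subtree is empty and the right one is not.
        have hr : r ≠ .nil := by
          rintro rfl
          exact h3 (by simp only [BinaryTree.numNodes]; omega)
        rw [treeSum_eq_zero y hr (by omega), h, insertZero_self]
        ring
    · obtain ⟨j, rfl⟩ : ∃ j, k = l.numNodes + 1 + j := ⟨k - l.numNodes - 1, by omega⟩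
      have hj : l.numNodes + 1 + j - l.numNodes - 1 = j := by omega
      rw [hj]
      have hE : ((deleteLeaf r j).map fun r' => BinaryTree.node a l r').elim 0
          (fun T' => treeSum y T' s t) = ∑ u ∈ Finset.Icc t s, y u *
            (treeSum y l s u * (deleteLeaf r j).elim 0
              (fun r' => treeSum y r' (s + l.numNodes + 1) (u + 1))) := by
        cases deleteLeaf r j with
        | none => simp
        | some r' => simp [treeSum]
      rw [hE, treeSum, treeSum, Finset.mul_sum, ← Finset.sum_add_distrib]
      refine Finset.sum_congr rfl fun u hu => ?_
      have hu := Finset.mem_Icc.1 hu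
      have := ihr (s + l.numNodes + 1) (u + 1) (k := j) (by omega) (by omega)
      rw [insertZero_of_lt (by omega), insertZero_of_lt (by omega),
        treeSum_insertZero_of_ge y l _ (by omega), treeSum_insertZero_of_ge y l _ (by omega),
        show s + ((l.numNodes + 1 + j : ℕ) : ℤ) = s + l.numNodes + 1 + j by push_cast; ring, this]
      ring

/-- The product of the inverses of the hook lengths of a binary tree. Its product with the
factorial of the number of nodes is the number of linear extensions. -/
def hookWeight : BinaryTree α → ℚ
  | .nil => 1
  | .node _ l r => hookWeight l * hookWeight r / (l.numNodes + r.numNodes + 1)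

theorem sum_hookWeight_deleteLeaf (T : BinaryTree α) :
    ∑ k ∈ Finset.range T.numNodes, (deleteLeaf T k).elim 0 hookWeight =
      T.numNodes * hookWeight T := by
  induction T with
  | nil => simp [BinaryTree.numNodes]
  | node a l r ihl ihr =>
    simp only [BinaryTree.numNodes]
    rw [add_assoc, add_comm r.numNodes 1, ← add_assoc, Finset.sum_range_add, Finset.sum_range_succ]
    have hl : ∑ k ∈ Finset.range l.numNodes, (deleteLeaf (.node a l r) k).elim 0 hookWeight =
        l.numNodes * hookWeight l * hookWeight r / (l.numNodes + r.numNodes) := by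
      rw [← ihl, Finset.sum_mul, Finset.sum_div]
      refine Finset.sum_congr rfl fun k hk => ?_
      rw [deleteLeaf, if_pos (Finset.mem_range.1 hk)]
      cases hd : deleteLeaf l k with
      | none => simp
      | some l' =>
        simp only [Option.map_some, Option.elim_some, hookWeight]
        rw [← numNodes_deleteLeaf hd]
        push_cast
        ring
    have hr : ∑ k ∈ Finset.range r.numNodes,
        (deleteLeaf (.node a l r) (l.numNodes + 1 + k)).elim 0 hookWeight =
        r.numNodes * hookWeight r * hookWeight l / (l.numNodes + r.numNodes) := by
      rw [← ihr, Finset.sum_mul, Finset.sum_div]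
      refine Finset.sum_congr rfl fun k hk => ?_
      rw [deleteLeaf, if_neg (by omega), if_neg (by omega),
        show l.numNodes + 1 + k - l.numNodes - 1 = k by omega]
      cases hd : deleteLeaf r k with
      | none => simp
      | some r' =>
        simp only [Option.map_some, Option.elim_some, hookWeight]
        rw [← numNodes_deleteLeaf hd]
        push_cast
        ring
    rw [hl, hr]
    simp only [deleteLeaf, lt_irrefl, if_false, if_true, hookWeight]
    by_cases h0 : l.numNodes + r.numNodes = 0
    · obtain rfl : l = .nil := eq_nil_of_numNodes_eq_zero (by omega)
      obtain rfl : r = .nil := eq_nil_of_numNodes_eq_zero (by omega)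
      simp [hookWeight, BinaryTree.numNodes]
    · have h0' : (l.numNodes + r.numNodes : ℚ) ≠ 0 := by exact_mod_cast h0
      rw [if_neg h0]
      push_cast
      simp only [Option.elim_none]
      field_simp
      ring

/-- The product of the forest polynomials of trees starting at given positions, evaluated at
`y`. -/
def forestSum (y : ℤ → R) (F : List (ℤ × BinaryTree α)) : R :=
  (F.map fun p => treeSum y p.2 p.1 1).prod

theorem map_forestSum (φ : R →+* S) (y : ℤ → R) (F : List (ℤ × BinaryTree α)) :
    φ (forestSum y F) = forestSum (fun j => φ (y j)) F := by
  simp [forestSum, map_list_prod, map_treeSum, Function.comp_def]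

/-- The number of nodes of a forest. -/
def forestSize (F : List (ℤ × BinaryTree α)) : ℕ := (F.map fun p => p.2.numNodes).sum

theorem isHomogeneous_forestSum (F : List (ℤ × BinaryTree α)) :
    (forestSum (MvPolynomial.X : ℤ → MvPolynomial ℤ R) F).IsHomogeneous (forestSize F) := by
  induction F with
  | nil => exact MvPolynomial.isHomogeneous_one _ _
  | cons p F ih =>
    simpa [forestSum, forestSize] using (isHomogeneous_treeSum p.2 p.1 1).mul ih

/-- The forest obtained by deleting the node at position `i`, provided that it is a leaf, and
moving the nodes to its right by one place to the left. The trees are listed from left to right. -/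
def deleteLeafForest : List (ℤ × BinaryTree α) → ℤ → Option (List (ℤ × BinaryTree α))
  | [], _ => none
  | p :: F, i =>
    if i < p.1 then none
    else if i < p.1 + p.2.numNodes then
      (deleteLeaf p.2 (i - p.1).toNat).map fun T' => (p.1, T') :: F.map fun q => (q.1 - 1, q.2)
    else (deleteLeafForest F i).map fun F' => p :: F'

/-- The trees of the list have disjoint supports and are listed from left to right. -/
def IsLeftToRight (F : List (ℤ × BinaryTree α)) : Prop :=
  F.Pairwise fun p q : ℤ × BinaryTree α => p.1 + p.2.numNodes ≤ q.1

theorem forestSum_insertZero_of_le (y : ℤ → R) (F : List (ℤ × BinaryTree α)) {i : ℤ} (hi : 1 ≤ i)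
    (h : ∀ p ∈ F, i ≤ p.1) :
    forestSum (insertZero i y) F = forestSum y (F.map fun q => (q.1 - 1, q.2)) := by
  rw [forestSum, forestSum, List.map_map]
  refine congrArg List.prod (List.map_congr_left fun p hp => ?_)
  rw [treeSum_insertZero_of_le y _ _ (h p hp), if_pos hi]
  rfl

theorem forestSum_cons (y : ℤ → R) (p : ℤ × BinaryTree α) (F : List (ℤ × BinaryTree α)) :
    forestSum y (p :: F) = treeSum y p.2 p.1 1 * forestSum y F := by
  simp [forestSum]

/-- The effect of a trimming operator on a forest polynomial. -/
theorem forestSum_insertZero_succ (y : ℤ → R) (F : List (ℤ × BinaryTree α)) (hF : IsLeftToRight F)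
    {i : ℤ} (hi : 1 ≤ i) :
    forestSum (insertZero (i + 1) y) F = forestSum (insertZero i y) F +
      y i * (deleteLeafForest F i).elim 0 (forestSum y) := by
  induction F with
  | nil => simp [forestSum, deleteLeafForest]
  | cons p F ih =>
    obtain ⟨hp, hF'⟩ := List.pairwise_cons.1 hF
    rw [deleteLeafForest]
    split_ifs with h1 h2
    · have h3 : ∀ q ∈ p :: F, i + 1 ≤ q.1 := by
        intro q hq
        rcases List.mem_cons.1 hq with rfl | hq
        · omega
        · have := hp q hq
          omega
      rw [forestSum_insertZero_of_le y _ (by omega) h3,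
        forestSum_insertZero_of_le y _ hi fun q hq => by have := h3 q hq; omega]
      simp
    · have h3 : ∀ q ∈ F, i + 1 ≤ q.1 := fun q hq => by have := hp q hq; omega
      rw [forestSum_cons, forestSum_cons, forestSum_insertZero_of_le y _ (by omega) h3,
        forestSum_insertZero_of_le y _ hi fun q hq => by have := h3 q hq; omega]
      obtain ⟨k, rfl⟩ : ∃ k : ℕ, i = p.1 + k := ⟨(i - p.1).toNat, by omega⟩
      rw [treeSum_insertZero_succ y p.2 p.1 1 (by omega) hi,
        show (p.1 + (k : ℤ) - p.1).toNat = k by omega]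
      cases deleteLeaf p.2 k with
      | none => simp
      | some T' =>
        simp only [Option.elim_some, Option.map_some, forestSum_cons]
        ring
    · rw [forestSum_cons, forestSum_cons, ih hF', treeSum_insertZero_of_ge y _ _ (by omega),
        treeSum_insertZero_of_ge y _ _ (by omega)]
      cases deleteLeafForest F i with
      | none => simp
      | some F' =>
        simp only [Option.elim_some, Option.map_some, forestSum_cons]
        ring

theorem forestSize_map_sub_one (F : List (ℤ × BinaryTree α)) :
    forestSize (F.map fun q => (q.1 - 1, q.2)) = forestSize F := by
  simp [forestSize, Function.comp_def]

theorem forestSize_deleteLeafForest {F F' : List (ℤ × BinaryTree α)} {i : ℤ}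
    (h : deleteLeafForest F i = some F') : forestSize F' + 1 = forestSize F := by
  induction F generalizing F' with
  | nil => simp [deleteLeafForest] at h
  | cons p F ih =>
    rw [deleteLeafForest] at h
    split_ifs at h
    · obtain ⟨T', hT', rfl⟩ := Option.map_eq_some_iff.1 h
      have h1 := numNodes_deleteLeaf hT'
      have h2 := forestSize_map_sub_one F
      simp only [forestSize, List.map_cons, List.sum_cons] at h2 ⊢
      omega
    · obtain ⟨F'', hF'', rfl⟩ := Option.map_eq_some_iff.1 h
      have := ih hF''
      simp only [forestSize, List.map_cons, List.sum_cons] at this ⊢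
      omega

theorem le_fst_of_mem_deleteLeafForest {F F' : List (ℤ × BinaryTree α)} (hF : IsLeftToRight F)
    {i b : ℤ} (h : deleteLeafForest F i = some F') (hb : ∀ p ∈ F, b ≤ p.1) (hbi : b ≤ i) :
    ∀ q ∈ F', b ≤ q.1 := by
  induction F generalizing F' with
  | nil => simp [deleteLeafForest] at h
  | cons p F ih =>
    obtain ⟨hp, hF'⟩ := List.pairwise_cons.1 hF
    rw [deleteLeafForest] at h
    split_ifs at h
    · obtain ⟨T', hT', rfl⟩ := Option.map_eq_some_iff.1 h
      intro q hq
      rcases List.mem_cons.1 hq with rfl | hq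
      · exact hb p (by simp)
      · obtain ⟨q', hq', rfl⟩ := List.mem_map.1 hq
        have := hp q' hq'
        dsimp only
        omega
    · obtain ⟨F'', hF'', rfl⟩ := Option.map_eq_some_iff.1 h
      intro q hq
      rcases List.mem_cons.1 hq with rfl | hq
      · exact hb q (by simp)
      · exact ih hF' hF'' (fun p hp => hb p (by simp [hp])) q hq

theorem isLeftToRight_deleteLeafForest {F F' : List (ℤ × BinaryTree α)} (hF : IsLeftToRight F)
    {i : ℤ} (h : deleteLeafForest F i = some F') : IsLeftToRight F' := by
  induction F generalizing F' with
  | nil => simp [deleteLeafForest] at h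
  | cons p F ih =>
    obtain ⟨hp, hF'⟩ := List.pairwise_cons.1 hF
    rw [deleteLeafForest] at h
    split_ifs at h
    · obtain ⟨T', hT', rfl⟩ := Option.map_eq_some_iff.1 h
      have hn := numNodes_deleteLeaf hT'
      refine List.pairwise_cons.2 ⟨fun q hq => ?_, List.pairwise_map.2 (hF'.imp fun h => ?_)⟩
      · obtain ⟨q', hq', rfl⟩ := List.mem_map.1 hq
        have := hp q' hq'
        dsimp only
        omega
      · dsimp only
        omega
    · obtain ⟨F'', hF'', rfl⟩ := Option.map_eq_some_iff.1 h
      exact List.pairwise_cons.2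
        ⟨le_fst_of_mem_deleteLeafForest hF' hF'' hp (by omega), ih hF' hF''⟩

/-- A forest protrudes beyond `N` if one of its nodes lies at a position greater than `N`. -/
def Protrudes (F : List (ℤ × BinaryTree α)) (N : ℤ) : Prop :=
  ∃ p ∈ F, p.2 ≠ .nil ∧ N + 1 < p.1 + p.2.numNodes

/-- Deleting a leaf moves the nodes to its right by only one place to the left. -/
theorem protrudes_deleteLeafForest {F F' : List (ℤ × BinaryTree α)} {N : ℤ}
    (h0 : Protrudes F (N + 1)) {i : ℤ} (hi : i ≤ N + 1) (h : deleteLeafForest F i = some F') :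
    Protrudes F' N := by
  induction F generalizing F' with
  | nil => simp [deleteLeafForest] at h
  | cons p F ih =>
    obtain ⟨q, hq, hq0, hqN⟩ := h0
    rw [deleteLeafForest] at h
    split_ifs at h
    · obtain ⟨T', hT', rfl⟩ := Option.map_eq_some_iff.1 h
      have hn := numNodes_deleteLeaf hT'
      rcases List.mem_cons.1 hq with rfl | hq
      · refine ⟨_, List.mem_cons_self, ?_, ?_⟩
        · rintro rfl
          simp only [BinaryTree.numNodes] at hn
          omega
        · dsimp only
          omega
      · refine ⟨(q.1 - 1, q.2), List.mem_cons_of_mem _ (List.mem_map.2 ⟨q, hq, rfl⟩), hq0, ?_⟩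
        dsimp only
        omega
    · obtain ⟨F'', hF'', rfl⟩ := Option.map_eq_some_iff.1 h
      rcases List.mem_cons.1 hq with rfl | hq
      · omega
      · obtain ⟨q', hq', h1⟩ := ih ⟨q, hq, hq0, hqN⟩ hF''
        exact ⟨q', List.mem_cons_of_mem _ hq', h1⟩

end ForestPolynomials

/-! ### Divided symmetrization of forest polynomials -/

section SymmForest

variable {α K : Type*} [Field K]

theorem listVal_insertIdx_zero (m : List K) {i : ℕ} (hi : i ≤ m.length) :
    listVal (m.insertIdx i 0) = insertZero (i + 1) (listVal m) := by
  funext j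
  unfold listVal insertZero
  by_cases hj : 1 ≤ j
  · obtain ⟨k, rfl⟩ : ∃ k : ℕ, j = k + 1 := ⟨(j - 1).toNat, by omega⟩
    simp only [hj, if_true, add_sub_cancel_right, Int.toNat_natCast, add_lt_add_iff_right,
      Nat.cast_lt, add_left_inj, Nat.cast_inj, List.getD_eq_getElem?_getD]
    rcases lt_trichotomy k i with h | rfl | h
    · rw [List.getElem?_insertIdx_of_lt h, if_pos h]
    · rw [List.getElem?_insertIdx_self]
      simp [hi]
    · rw [List.getElem?_insertIdx_of_gt h, if_neg (by omega), if_neg (by omega), if_pos (by omega),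
        show ((k : ℤ) - 1).toNat = k - 1 by omega]
  · have h2 : j < i + 1 := by omega
    simp [hj, h2]

theorem eval_treeSum_X (v : ℤ → K) (T : BinaryTree α) (s t : ℤ) :
    MvPolynomial.eval v (treeSum MvPolynomial.X T s t) = treeSum v T s t := by
  simp [map_treeSum]

theorem eval_forestSum_X (v : ℤ → K) (F : List (ℤ × BinaryTree α)) :
    MvPolynomial.eval v (forestSum MvPolynomial.X F) = forestSum v F := by
  simp [map_forestSum]

/-- The divided symmetrization in `n + 1` variables of the forest polynomial of a forest with `n`
nodes vanishes if some node lies at a position greater than `n`. -/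
theorem listSymm_forestSum_of_protrudes [CharZero K] (n : ℕ) (F : List (ℤ × BinaryTree α))
    (hF : IsLeftToRight F) (hn : forestSize F = n) (hP : Protrudes F n) (l : List K) (hl : l.Nodup)
    (hlen : l.length = n + 1) : listSymm (fun m => forestSum (listVal m) F) l = 0 := by
  induction n generalizing F l with
  | zero =>
    obtain ⟨p, hp, h0, -⟩ := hP
    have : p.2.numNodes ≤ forestSize F :=
      List.single_le_sum (by simp) _ (List.mem_map.2 ⟨p, hp, rfl⟩)
    exact absurd (eq_nil_of_numNodes_eq_zero (by omega)) h0
  | succ n ih =>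
    obtain ⟨l₀, hl₀, hlen₀, H⟩ := exists_listSymm_eval_eq_sum (K := K) n
    have hom := isHomogeneous_forestSum (R := K) F
    rw [hn] at hom
    have := H _ hom (fun i m => (deleteLeafForest F (i + 1)).elim 0 (forestSum (listVal m))) (by
      intro m hm i hi
      rw [eval_forestSum_X, eval_forestSum_X, listVal_insertIdx_zero m (by omega),
        listVal_insertIdx_zero m (by omega), Nat.cast_add_one,
        forestSum_insertZero_succ _ _ hF (by omega), add_sub_cancel_left, listVal_succ]) l hl hlen
    simp only [eval_forestSum_X] at this
    rw [this]
    refine Finset.sum_eq_zero fun i hi => ?_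
    have hi := Finset.mem_range.1 hi
    cases hd : deleteLeafForest F (i + 1) with
    | none => simp [listSymm]
    | some F' =>
      have hs := forestSize_deleteLeafForest hd
      simp only [Option.elim_some]
      push_cast at hP
      exact ih F' (isLeftToRight_deleteLeafForest hF hd) (by omega)
        (protrudes_deleteLeafForest hP (by omega) hd) l₀ hl₀ hlen₀

/-- The divided symmetrization of the forest polynomial of a tree with nodes at `1, ..., n` is the
number of its linear extensions. -/
theorem listSymm_treeSum [CharZero K] (n : ℕ) (T : BinaryTree α) (hn : T.numNodes = n) (l : List K)
    (hl : l.Nodup) (hlen : l.length = n + 1) :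
    listSymm (fun m => treeSum (listVal m) T 1 1) l = ((n.factorial * hookWeight T : ℚ) : K) := by
  induction n generalizing T l with
  | zero =>
    obtain rfl := eq_nil_of_numNodes_eq_zero hn
    obtain ⟨x, rfl⟩ := List.length_eq_one_iff.1 hlen
    simp [listSymm, treeSum, hookWeight, consecDiff]
  | succ n ih =>
    obtain ⟨l₀, hl₀, hlen₀, H⟩ := exists_listSymm_eval_eq_sum (K := K) n
    have hom := isHomogeneous_treeSum (R := K) T 1 1
    rw [hn] at hom
    have := H _ hom (fun i m => (deleteLeaf T i).elim 0 fun T' => treeSum (listVal m) T' 1 1) (by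
      intro m hm i hi
      have h1 := treeSum_insertZero_succ (listVal m) T 1 1 (k := i) (by omega) (by omega)
      rw [eval_treeSum_X, eval_treeSum_X, listVal_insertIdx_zero m (by omega),
        listVal_insertIdx_zero m (by omega), Nat.cast_add_one, add_comm (i : ℤ) 1, h1,
        add_sub_cancel_left, add_comm 1 (i : ℤ), listVal_succ]) l hl hlen
    simp only [eval_treeSum_X] at this
    rw [this]
    have h2 : ∀ i ∈ Finset.range (n + 1),
        listSymm (fun m => (deleteLeaf T i).elim 0 fun T' => treeSum (listVal m) T' 1 1) l₀ =
        ((n.factorial * (deleteLeaf T i).elim 0 hookWeight : ℚ) : K) := by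
      intro i hi
      cases hd : deleteLeaf T i with
      | none => simp [listSymm]
      | some T' =>
        have hs := numNodes_deleteLeaf hd
        exact ih T' (by omega) l₀ hl₀ hlen₀
    rw [Finset.sum_congr rfl h2, ← Rat.cast_sum, ← Finset.mul_sum, ← hn,
      sum_hookWeight_deleteLeaf, hn, Nat.factorial_succ]
    push_cast
    ring

end SymmForest

/-! ### Well-formed labeled forests and insertion -/

noncomputable section LabeledForests

/-- The label of the root of a tree, if there is one. -/
def rootLabel : BinaryTree Letter → Option Letter
  | .nil => none
  | .node a _ _ => some a

/-- The labels of the nodes of a tree. -/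
def treeLabels : BinaryTree Letter → List Letter
  | .nil => []
  | .node a l r => a :: (treeLabels l ++ treeLabels r)

/-- A tree placed at `s, s + 1, ...` is well formed if the value of each label lies in the support
of the subtree below it, and the label of each node is larger than that of its left child and
smaller than that of its right child. -/
def TreeWF : BinaryTree Letter → ℤ → Prop
  | .nil, _ => True
  | .node a l r, s => (s ≤ a.val ∧ a.val < s + l.numNodes + r.numNodes + 1) ∧
      (∀ b ∈ rootLabel l, b < a) ∧ (∀ b ∈ rootLabel r, a < b) ∧
      TreeWF l s ∧ TreeWF r (s + l.numNodes + 1)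

/-- The tree `T`, placed at `s, s + 1, ...`, as a forest with at most one tree. -/
def placeTree (s : ℤ) : BinaryTree Letter → IndexedForest
  | .nil => []
  | .node a l r => [⟨s, a, l, r⟩]

/-- The position of the root of a tree. -/
def IndexedTree.rootPos (u : IndexedTree) : ℤ := u.start + u.left.numNodes

/-- The forest obtained from a tree by removing its root. -/
def IndexedTree.children (u : IndexedTree) : IndexedForest :=
  placeTree u.start u.left ++ placeTree (u.rootPos + 1) u.right

/-- The first position to the right of the support of a tree. -/
def IndexedTree.endPos (u : IndexedTree) : ℤ := u.start + u.toTree.numNodes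

/-- The supports of the trees are separated by gaps, and the trees are listed from left to
right. -/
def Separated (F : IndexedForest) : Prop :=
  F.Pairwise fun T T' : IndexedTree => T.endPos < T'.start

/-- All labels of a forest. -/
def forestLabels (F : IndexedForest) : List Letter := F.flatMap fun T => treeLabels T.toTree

/-- A labeled forest is well formed if its trees are, their supports are separated, and its labels
are distinct. These are the P-symbols of the injective words. -/
structure ForestWF (F : IndexedForest) : Prop where
  separated : Separated F
  tree : ∀ T ∈ F, TreeWF T.toTree T.start
  nodup : (forestLabels F).Nodup

theorem IndexedTree.mem_support {T : IndexedTree} {i : ℤ} :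
    i ∈ T.support ↔ T.start ≤ i ∧ i < T.endPos := Finset.mem_Ico

theorem IndexedTree.numNodes_toTree (T : IndexedTree) :
    T.toTree.numNodes = T.left.numNodes + T.right.numNodes + 1 := rfl

theorem IndexedTree.endPos_eq (T : IndexedTree) :
    T.endPos = T.start + T.left.numNodes + T.right.numNodes + 1 := by
  rw [IndexedTree.endPos, IndexedTree.numNodes_toTree]
  push_cast
  ring

theorem IndexedTree.start_lt_endPos (T : IndexedTree) : T.start < T.endPos := by
  rw [T.endPos_eq]
  omega

theorem mem_placeTree {s : ℤ} {t : BinaryTree Letter} {T : IndexedTree} :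
    T ∈ placeTree s t ↔ T.start = s ∧ T.toTree = t := by
  cases t with
  | nil => simp [placeTree, IndexedTree.toTree]
  | node a l r =>
    obtain ⟨s', a', l', r'⟩ := T
    simp [placeTree, IndexedTree.toTree]

theorem IndexedTree.mem_children {u T : IndexedTree} : T ∈ u.children ↔
    (T.start = u.start ∧ T.toTree = u.left) ∨ (T.start = u.rootPos + 1 ∧ T.toTree = u.right) := by
  simp [children, mem_placeTree]

theorem forestLabels_placeTree (s : ℤ) (t : BinaryTree Letter) :
    forestLabels (placeTree s t) = treeLabels t := by
  cases t <;> simp [placeTree, forestLabels, treeLabels, IndexedTree.toTree]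

theorem forestLabels_append (F G : IndexedForest) :
    forestLabels (F ++ G) = forestLabels F ++ forestLabels G := by
  simp [forestLabels]

theorem forestLabels_cons (u : IndexedTree) (F : IndexedForest) :
    forestLabels (u :: F) = treeLabels u.toTree ++ forestLabels F := by
  simp [forestLabels]

theorem forestLabels_children (u : IndexedTree) :
    treeLabels u.toTree = u.label :: forestLabels u.children := by
  rw [IndexedTree.children, forestLabels_append, forestLabels_placeTree, forestLabels_placeTree]
  rfl

theorem forestLabels_perm (F₁ F₂ : IndexedForest) (u : IndexedTree) :
    (forestLabels (F₁ ++ u :: F₂)).Perm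
      (u.label :: forestLabels (F₁ ++ (u.children ++ F₂))) := by
  rw [forestLabels_append, forestLabels_cons, forestLabels_children, forestLabels_append,
    forestLabels_append]
  exact List.perm_middle

theorem separated_append_cons {F₁ F₂ : IndexedForest} {u : IndexedTree} :
    Separated (F₁ ++ u :: F₂) ↔ Separated F₁ ∧ Separated F₂ ∧ (∀ T ∈ F₁, T.endPos < u.start) ∧
      (∀ T ∈ F₂, u.endPos < T.start) ∧ ∀ T ∈ F₁, ∀ T' ∈ F₂, T.endPos < T'.start := by
  simp only [Separated, List.pairwise_append, List.pairwise_cons, List.mem_cons, forall_eq_or_imp]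
  constructor
  · rintro ⟨h1, ⟨h2, h3⟩, h4⟩
    exact ⟨h1, h3, fun T hT => (h4 T hT).1, h2, fun T hT => (h4 T hT).2⟩
  · rintro ⟨h1, h2, h3, h4, h5⟩
    exact ⟨h1, ⟨h4, h2⟩, fun T hT => ⟨h3 T hT, h5 T hT⟩⟩

/-- The children of a tree lie in its support and leave its root position free. -/
theorem IndexedTree.bounds_of_mem_children {u T : IndexedTree} (h : T ∈ u.children) :
    u.start ≤ T.start ∧ T.endPos ≤ u.endPos ∧ (T.endPos = u.rootPos ∨ T.start = u.rootPos + 1) := by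
  have h1 := u.endPos_eq
  simp only [IndexedTree.rootPos]
  rcases IndexedTree.mem_children.1 h with ⟨h2, h3⟩ | ⟨h2, h3⟩
  · have h4 : T.endPos = u.start + u.left.numNodes := by rw [endPos, h2, h3]
    omega
  · have h4 : T.endPos = u.rootPos + 1 + u.right.numNodes := by rw [endPos, h2, h3]
    simp only [IndexedTree.rootPos] at h2 h4
    omega

theorem separated_children (u : IndexedTree) : Separated u.children := by
  obtain ⟨s, a, l, r⟩ := u
  cases l <;> cases r <;>
    simp [IndexedTree.children, placeTree, Separated, IndexedTree.endPos, IndexedTree.rootPos,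
      IndexedTree.toTree]

theorem Separated.replace_children {F₁ F₂ : IndexedForest} {u : IndexedTree}
    (h : Separated (F₁ ++ u :: F₂)) : Separated (F₁ ++ (u.children ++ F₂)) := by
  obtain ⟨h1, h2, h3, h4, h5⟩ := separated_append_cons.1 h
  refine List.pairwise_append.2 ⟨h1, List.pairwise_append.2 ⟨separated_children u, h2, ?_⟩, ?_⟩
  · intro T hT T' hT'
    have := (IndexedTree.bounds_of_mem_children hT).2.1
    have := h4 T' hT'
    omega
  · intro T hT T' hT'
    rcases List.mem_append.1 hT' with hT' | hT'
    · have := (IndexedTree.bounds_of_mem_children hT').1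
      have := h3 T hT
      omega
    · exact h5 T hT T' hT'

theorem ForestWF.replace_children {F₁ F₂ : IndexedForest} {u : IndexedTree}
    (h : ForestWF (F₁ ++ u :: F₂)) : ForestWF (F₁ ++ (u.children ++ F₂)) where
  separated := h.separated.replace_children
  tree := by
    intro T hT
    rcases List.mem_append.1 hT with hT | hT
    · exact h.tree T (by simp [hT])
    · rcases List.mem_append.1 hT with hT | hT
      · obtain ⟨-, -, -, hl, hr⟩ := h.tree u (by simp)
        rcases IndexedTree.mem_children.1 hT with ⟨h2, h3⟩ | ⟨h2, h3⟩
        · rwa [h2, h3]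
        · rwa [h2, h3]
      · exact h.tree T (by simp [hT])
  nodup := ((forestLabels_perm F₁ F₂ u).nodup_iff.1 h.nodup).of_cons

/-- Every free position of a separated forest is the root position of a tree whose children
belong to the forest. -/
theorem exists_tree_of_free_position (a : Letter) (G : IndexedForest) (hG : Separated G) (p : ℤ)
    (hp : ∀ T ∈ G, p ∉ T.support) : ∃ F₁ u F₂, G = F₁ ++ (IndexedTree.children u ++ F₂) ∧
      u.rootPos = p ∧ u.label = a ∧ Separated (F₁ ++ u :: F₂) ∧
      (u.start = p ∨ ∃ T ∈ G, u.start = T.start) := by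
  have right : ∀ G : IndexedForest, Separated G → (∀ T ∈ G, p < T.start) →
      ∃ r F₂, G = placeTree (p + 1) r ++ F₂ ∧ Separated F₂ ∧
        ∀ T ∈ F₂, p + r.numNodes + 1 < T.start := by
    intro G hG hp
    cases G with
    | nil => exact ⟨.nil, [], rfl, List.Pairwise.nil, by simp⟩
    | cons T G =>
      obtain ⟨h1, h2⟩ := List.pairwise_cons.1 hG
      have hT := hp T (by simp)
      by_cases h : T.start = p + 1
      · refine ⟨T.toTree, G, ?_, h2, fun T' hT' => ?_⟩
        · rw [← h]
          rfl
        · have := h1 T' hT'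
          rw [IndexedTree.endPos] at this
          omega
      · refine ⟨.nil, T :: G, rfl, hG, ?_⟩
        intro T' hT'
        simp only [BinaryTree.numNodes]
        rcases List.mem_cons.1 hT' with rfl | hT'
        · omega
        · have := h1 T' hT'
          have := T.start_lt_endPos
          omega
  induction G with
  | nil =>
    exact ⟨[], ⟨p, a, .nil, .nil⟩, [], rfl, by simp [IndexedTree.rootPos, BinaryTree.numNodes], rfl,
      List.pairwise_singleton _ _, Or.inl rfl⟩
  | cons T G ih =>
    obtain ⟨h1, h2⟩ := List.pairwise_cons.1 hG
    have hTp : p < T.start ∨ T.endPos ≤ p := by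
      have := hp T (by simp)
      rw [IndexedTree.mem_support] at this
      omega
    have hlt := T.start_lt_endPos
    rcases hTp with h | h
    · obtain ⟨r, F₂, hGr, h3, h4⟩ := right (T :: G) hG (by
        intro T' hT'
        rcases List.mem_cons.1 hT' with rfl | hT'
        · exact h
        · have := h1 T' hT'
          omega)
      refine ⟨[], ⟨p, a, .nil, r⟩, F₂, ?_, by simp [IndexedTree.rootPos, BinaryTree.numNodes], rfl,
        ?_, Or.inl rfl⟩
      · simpa [IndexedTree.children, IndexedTree.rootPos, BinaryTree.numNodes, placeTree] using hGr
      · refine List.pairwise_cons.2 ⟨fun T' hT' => ?_, h3⟩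
        have := h4 T' hT'
        simp only [IndexedTree.endPos_eq, BinaryTree.numNodes]
        omega
    · rcases h.lt_or_eq with h | h
      · obtain ⟨F₁, u, F₂, rfl, h3, h4, h5, h6⟩ := ih h2 fun T' hT' => hp T' (by simp [hT'])
        refine ⟨T :: F₁, u, F₂, rfl, h3, h4, List.pairwise_cons.2 ⟨fun T' hT' => ?_, h5⟩, ?_⟩
        · have hu : T.endPos < u.start := by
            rcases h6 with h6 | ⟨T'', hT'', h6⟩
            · omega
            · rw [h6]
              exact h1 _ hT''
          rcases List.mem_append.1 hT' with hT' | hT'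
          · exact h1 T' (by simp [hT'])
          · rcases List.mem_cons.1 hT' with rfl | hT'
            · exact hu
            · exact h1 T' (by simp [hT'])
        · rcases h6 with h6 | ⟨T'', hT'', h6⟩
          · exact Or.inl h6
          · exact Or.inr ⟨T'', List.mem_cons_of_mem _ hT'', h6⟩
      · obtain ⟨r, F₂, rfl, h3, h4⟩ := right G h2 (fun T' hT' => by
          have := h1 T' hT'
          omega)
        have hpos : T.start + T.toTree.numNodes = p := h
        refine ⟨[], ⟨T.start, a, T.toTree, r⟩, F₂, ?_, hpos, rfl, ?_,
          Or.inr ⟨T, by simp, rfl⟩⟩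
        · simp only [IndexedTree.children, IndexedTree.rootPos, hpos]
          rfl
        · refine List.pairwise_cons.2 ⟨fun T' hT' => ?_, h3⟩
          have := h4 T' hT'
          simp only [IndexedTree.endPos_eq]
          omega

theorem treeAt_eq_some {G : IndexedForest} {i : ℤ} {T : IndexedTree} (h : G.treeAt i = some T) :
    T ∈ G ∧ i ∈ T.support :=
  ⟨List.mem_of_find?_eq_some h, by simpa using List.find?_some h⟩

theorem treeAt_eq_none {G : IndexedForest} {i : ℤ} :
    G.treeAt i = none ↔ ∀ T ∈ G, i ∉ T.support := by
  simp [IndexedForest.treeAt]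

theorem treeAt_append {F G : IndexedForest} {i : ℤ} :
    IndexedForest.treeAt (F ++ G) i = (F.treeAt i).or (G.treeAt i) := by
  simp [IndexedForest.treeAt]

theorem treeAt_replace_children {F₁ F₂ : IndexedForest} {u : IndexedTree}
    (h : Separated (F₁ ++ u :: F₂)) {i : ℤ} (h1 : u.start - 1 ≤ i) (h2 : i ≤ u.endPos) :
    IndexedForest.treeAt (F₁ ++ (u.children ++ F₂)) i = u.children.treeAt i := by
  obtain ⟨-, -, h3, h4, -⟩ := separated_append_cons.1 h
  rw [treeAt_append, treeAt_append, treeAt_eq_none.2, treeAt_eq_none (G := F₂) |>.2]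
  · simp
  · intro T hT hi
    have := h4 T hT
    have := IndexedTree.mem_support.1 hi
    omega
  · intro T hT hi
    have := h3 T hT
    have := IndexedTree.mem_support.1 hi
    omega

theorem treeAt_placeTree (s : ℤ) (t : BinaryTree Letter) (i : ℤ) :
    IndexedForest.treeAt (placeTree s t) i =
      if s ≤ i ∧ i < s + t.numNodes then (placeTree s t).head? else none := by
  cases t with
  | nil => simp [placeTree, IndexedForest.treeAt]
  | node a l r =>
    simp only [placeTree, IndexedForest.treeAt, IndexedTree.support, IndexedTree.toTree,
      Finset.mem_Ico, List.head?_cons]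
    split_ifs with h
    · exact List.find?_cons_of_pos (by simpa using h)
    · exact List.find?_cons_of_neg (by simpa using h)

theorem treeAt_children (u : IndexedTree) (i : ℤ) : u.children.treeAt i =
    if u.start ≤ i ∧ i < u.rootPos then (placeTree u.start u.left).head?
    else if u.rootPos + 1 ≤ i ∧ i < u.endPos then (placeTree (u.rootPos + 1) u.right).head?
    else none := by
  have h1 : u.rootPos = u.start + u.left.numNodes := rfl
  have h2 := u.endPos_eq
  rw [IndexedTree.children, treeAt_append, treeAt_placeTree, treeAt_placeTree, ← h1,
    show u.rootPos + 1 + u.right.numNodes = u.endPos by omega]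
  split_ifs with h3 h4
  · omega
  · simp
  · simp
  · simp

theorem orderedInsert_append {F₁ F₂ : IndexedForest} {u : IndexedTree}
    (h₁ : ∀ T ∈ F₁, T.start < u.start) (h₂ : ∀ T ∈ F₂, u.start ≤ T.start) :
    (F₁ ++ F₂).orderedInsert (fun T T' : IndexedTree => T.start ≤ T'.start) u = F₁ ++ u :: F₂ := by
  induction F₁ with
  | nil =>
    cases F₂ with
    | nil => rfl
    | cons T F₂ => exact List.orderedInsert_cons_of_le _ _ (h₂ T (by simp))
  | cons T F₁ ih =>
    have := h₁ T (by simp)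
    rw [List.cons_append, List.orderedInsert_of_not_le _ _ (by omega),
      ih fun T hT => h₁ T (by simp [hT])]
    rfl

theorem insertLetter_eq {F₁ F₂ : IndexedForest} {u : IndexedTree}
    (h : Separated (F₁ ++ u :: F₂))
    (hp : IndexedForest.newPos (F₁ ++ (u.children ++ F₂)) u.label = u.rootPos) :
    IndexedForest.insertLetter (F₁ ++ (u.children ++ F₂)) u.label = F₁ ++ u :: F₂ := by
  obtain ⟨-, -, h3, h4, -⟩ := separated_append_cons.1 h
  have hu := u.endPos_eq
  have hr : u.rootPos = u.start + u.left.numNodes := rfl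
  have e1 : IndexedForest.treeAt (F₁ ++ (u.children ++ F₂)) (u.rootPos - 1) =
      (placeTree u.start u.left).head? := by
    rw [treeAt_replace_children h (by omega) (by omega), treeAt_children]
    split_ifs with h5 h6
    · rfl
    · omega
    · rw [eq_nil_of_numNodes_eq_zero (T := u.left) (by omega)]
      rfl
  have e2 : IndexedForest.treeAt (F₁ ++ (u.children ++ F₂)) (u.rootPos + 1) =
      (placeTree (u.rootPos + 1) u.right).head? := by
    rw [treeAt_replace_children h (by omega) (by omega), treeAt_children]
    split_ifs with h5 h6
    · omega
    · rfl
    · rw [eq_nil_of_numNodes_eq_zero (T := u.right) (by omega)]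
      rfl
  have e3 : (F₁ ++ (u.children ++ F₂)).filter (fun T => decide
      (u.rootPos - 1 ∉ T.support ∧ u.rootPos + 1 ∉ T.support)) = F₁ ++ F₂ := by
    rw [List.filter_append, List.filter_append, List.filter_eq_self.2, List.filter_eq_nil_iff.2,
      List.filter_eq_self (l := F₂) |>.2, List.nil_append]
    · intro T hT
      have := h4 T hT
      simp only [IndexedTree.mem_support, decide_eq_true_eq]
      omega
    · intro T hT
      have h5 := IndexedTree.bounds_of_mem_children hT
      have h6 := T.start_lt_endPos
      simp only [IndexedTree.mem_support, decide_eq_true_eq]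
      omega
    · intro T hT
      have := h3 T hT
      simp only [IndexedTree.mem_support, decide_eq_true_eq]
      omega
  have e4 : (⟨(placeTree u.start u.left).head?.elim u.rootPos IndexedTree.start, u.label,
      (placeTree u.start u.left).head?.elim .nil IndexedTree.toTree,
      (placeTree (u.rootPos + 1) u.right).head?.elim .nil IndexedTree.toTree⟩ : IndexedTree) =
        u := by
    obtain ⟨s, a, l, r⟩ := u
    cases l <;> cases r <;> simp [placeTree, IndexedTree.toTree, IndexedTree.rootPos]
  simp only [IndexedForest.insertLetter, hp, e1, e2, e3, e4]
  refine orderedInsert_append (fun T hT => ?_) fun T hT => ?_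
  · have := h3 T hT
    have := T.start_lt_endPos
    omega
  · have := h4 T hT
    have := u.start_lt_endPos
    omega

theorem TreeWF.val_mem {t : BinaryTree Letter} {s : ℤ} (h : TreeWF t s) {b : Letter}
    (hb : b ∈ rootLabel t) : s ≤ b.val ∧ b.val < s + t.numNodes := by
  cases t with
  | nil => simp [rootLabel] at hb
  | node a l r =>
    obtain rfl : a = b := by simpa [rootLabel] using hb
    refine ⟨h.1.1, ?_⟩
    have := h.1.2
    simp only [BinaryTree.numNodes]
    push_cast
    omega

/-- Inserting the label of a root into the forest from which that root has been removed restores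
the forest. -/
theorem insertLetter_children {F₁ F₂ : IndexedForest} {u : IndexedTree}
    (h : ForestWF (F₁ ++ u :: F₂)) :
    IndexedForest.insertLetter (F₁ ++ (u.children ++ F₂)) u.label = F₁ ++ u :: F₂ := by
  refine insertLetter_eq h.separated ?_
  have hu := u.endPos_eq
  have hr : u.rootPos = u.start + u.left.numNodes := rfl
  obtain ⟨h1, h2, h3, -, -⟩ := h.tree u (by simp)
  rw [IndexedForest.newPos, treeAt_replace_children h.separated (by omega) (by omega),
    treeAt_children]
  split_ifs with h4 h5
  · cases hl : u.left with
    | nil =>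
      rw [hl] at hr
      simp only [BinaryTree.numNodes] at hr
      omega
    | node b l r =>
      simp only [placeTree, List.head?_cons, IndexedTree.toTree]
      rw [if_neg (h2 b (by simp [hl, rootLabel])).not_gt, ← hl, hr]
  · cases hl : u.right with
    | nil =>
      rw [hl] at hu
      simp only [BinaryTree.numNodes] at hu
      omega
    | node b l r =>
      simp only [placeTree, List.head?_cons]
      rw [if_pos (h3 b (by simp [hl, rootLabel]))]
      ring
  · dsimp only
    omega

theorem Letter.lt_of_val_lt {a b : Letter} (h : a.val < b.val) : a < b :=
  Prod.Lex.lt_iff.2 (Or.inl h)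

theorem Separated.eq_or {G : IndexedForest} (hG : Separated G) {T T' : IndexedTree} (hT : T ∈ G)
    (hT' : T' ∈ G) : T = T' ∨ T.endPos < T'.start ∨ T'.endPos < T.start := by
  obtain ⟨F₁, F₂, rfl⟩ := List.append_of_mem hT
  obtain ⟨-, -, h3, h4, -⟩ := separated_append_cons.1 hG
  rcases List.mem_append.1 hT' with h | h
  · exact Or.inr (Or.inr (h3 _ h))
  · rcases List.mem_cons.1 h with h | h
    · exact Or.inl h.symm
    · exact Or.inr (Or.inl (h4 _ h))

theorem Separated.eq_of_mem {G : IndexedForest} (hG : Separated G) {T T' : IndexedTree}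
    (hT : T ∈ G) (hT' : T' ∈ G) {i : ℤ} (h : T.start - 1 ≤ i ∧ i ≤ T.endPos) (h' : i ∈ T'.support) :
    T = T' := by
  have := IndexedTree.mem_support.1 h'
  rcases hG.eq_or hT hT' with h1 | h1 | h1
  · exact h1
  · omega
  · omega

/-- Inserting a new letter into a well-formed forest yields a well-formed forest, from which the
old one is recovered by removing the root with that letter. -/
theorem exists_insertLetter_eq {G : IndexedForest} (hG : ForestWF G) {a : Letter}
    (ha : a ∉ forestLabels G) : ∃ F₁ u F₂, G = F₁ ++ (IndexedTree.children u ++ F₂) ∧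
      u.label = a ∧ G.newPos a = u.rootPos ∧ G.insertLetter a = F₁ ++ u :: F₂ ∧
      ForestWF (F₁ ++ u :: F₂) := by
  have hfree : ∀ T ∈ G, G.newPos a ∉ T.support := by
    intro T hT hmem
    rw [IndexedForest.newPos] at hmem
    cases hat : G.treeAt a.val with
    | none =>
      rw [hat] at hmem
      exact treeAt_eq_none.1 hat T hT hmem
    | some T' =>
      obtain ⟨hT', -⟩ := treeAt_eq_some hat
      have hm := IndexedTree.mem_support.1 hmem
      have hlt := T'.start_lt_endPos
      have hst : T'.start + T'.toTree.numNodes = T'.endPos := rfl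
      simp only [hat, hst] at hm hmem
      split_ifs at hm hmem
      · obtain rfl := hG.separated.eq_of_mem hT' hT (by omega) hmem
        omega
      · obtain rfl := hG.separated.eq_of_mem hT' hT (by omega) hmem
        omega
  obtain ⟨F₁, u, F₂, rfl, hpos, rfl, hsep, -⟩ :=
    exists_tree_of_free_position a G hG.separated _ hfree
  obtain ⟨-, -, h3, h4, -⟩ := separated_append_cons.1 hsep
  have hu := u.endPos_eq
  have hr : u.rootPos = u.start + u.left.numNodes := rfl
  have hwl : TreeWF u.left u.start := by
    cases hl : u.left with
    | nil => trivial
    | node b l r => exact hG.tree ⟨u.start, b, l, r⟩ (by simp [IndexedTree.mem_children, hl,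
        IndexedTree.toTree])
  have hwr : TreeWF u.right (u.rootPos + 1) := by
    cases hl : u.right with
    | nil => trivial
    | node b l r => exact hG.tree ⟨u.rootPos + 1, b, l, r⟩ (by simp [IndexedTree.mem_children, hl,
        IndexedTree.toTree])
  have hval : (u.start ≤ u.label.val ∧ u.label.val < u.endPos) ∧
      (∀ b ∈ rootLabel u.left, b < u.label) ∧ (∀ b ∈ rootLabel u.right, u.label < b) := by
    have hvl := fun b hb => hwl.val_mem (b := b) hb
    have hvr := fun b hb => hwr.val_mem (b := b) hb
    have hne : ∀ T ∈ F₁ ++ (u.children ++ F₂), u.label ≠ T.label := by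
      rintro T hT h
      exact ha (List.mem_flatMap.2 ⟨T, hT, by simp [IndexedTree.toTree, treeLabels, h]⟩)
    rw [IndexedForest.newPos] at hpos
    cases hat : IndexedForest.treeAt (F₁ ++ (u.children ++ F₂)) u.label.val with
    | none =>
      simp only [hat] at hpos
      refine ⟨by omega, fun b hb => Letter.lt_of_val_lt ?_, fun b hb => Letter.lt_of_val_lt ?_⟩
      · have := hvl b hb
        omega
      · have := hvr b hb
        omega
    | some T =>
      obtain ⟨hT, hTa⟩ := treeAt_eq_some hat
      have hTa := IndexedTree.mem_support.1 hTa
      have hst : T.start + T.toTree.numNodes = T.endPos := rfl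
      have hlt := T.start_lt_endPos
      simp only [hat, hst] at hpos
      -- The tree `T` is adjacent to the root position of `u`, so it is a child of `u`.
      have hTu : T ∈ u.children := by
        rcases List.mem_append.1 hT with h | h
        · have := h3 T h
          split_ifs at hpos <;> omega
        · rcases List.mem_append.1 h with h | h
          · exact h
          · have := h4 T h
            split_ifs at hpos <;> omega
      have hroot : rootLabel T.toTree = some T.label := rfl
      split_ifs at hpos with hlab
      · rcases IndexedTree.mem_children.1 hTu with ⟨h1, h2⟩ | ⟨h1, h2⟩
        · omega
        · have hs : T.endPos = u.endPos := by rw [IndexedTree.endPos, h2]; omega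
          refine ⟨by omega, fun b hb => Letter.lt_of_val_lt ?_, fun b hb => ?_⟩
          · have := hvl b hb
            omega
          · rw [← h2, hroot] at hb
            cases hb
            exact hlab
      · rcases IndexedTree.mem_children.1 hTu with ⟨h1, h2⟩ | ⟨h1, h2⟩
        · refine ⟨by omega, fun b hb => ?_, fun b hb => Letter.lt_of_val_lt ?_⟩
          · rw [← h2, hroot] at hb
            cases hb
            exact lt_of_le_of_ne (not_lt.1 hlab) (hne T hT).symm
          · have := hvr b hb
            omega
        · omega
  refine ⟨F₁, u, F₂, rfl, rfl, hpos.symm, insertLetter_eq hsep hpos.symm, hsep, ?_, ?_⟩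
  · intro T hT
    rcases List.mem_append.1 hT with h | h
    · exact hG.tree T (by simp [h])
    · rcases List.mem_cons.1 h with rfl | h
      · exact ⟨by omega, hval.2.1, hval.2.2, hwl, hwr⟩
      · exact hG.tree T (by simp [h])
  · exact (forestLabels_perm F₁ F₂ u).nodup_iff.2 (List.nodup_cons.2 ⟨ha, hG.nodup⟩)

theorem pSymbol_concat (W : Word) (a : Letter) :
    pSymbol (W ++ [a]) = (pSymbol W).insertLetter a := by
  simp [pSymbol]

theorem forestWF_nil : ForestWF [] := ⟨List.Pairwise.nil, by simp, by simp [forestLabels]⟩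

theorem pSymbol_wf {W : Word} (hW : W.Nodup) :
    ForestWF (pSymbol W) ∧ (forestLabels (pSymbol W)).Perm W := by
  induction W using List.reverseRecOn with
  | nil => exact ⟨forestWF_nil, List.Perm.refl _⟩
  | append_singleton W a ih =>
    obtain ⟨h1, h2⟩ := ih (List.nodup_append.1 hW).1
    have ha : a ∉ forestLabels (pSymbol W) := by
      rw [h2.mem_iff]
      have := (List.perm_append_singleton a W).nodup_iff.1 hW
      exact (List.nodup_cons.1 this).1
    obtain ⟨F₁, u, F₂, h3, rfl, -, h4, h5⟩ := exists_insertLetter_eq h1 ha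
    rw [pSymbol_concat, h4]
    refine ⟨h5, (forestLabels_perm F₁ F₂ u).trans ?_⟩
    rw [← h3]
    exact (h2.cons _).trans (List.perm_append_singleton _ _).symm

/-- The parking procedure fills the support of the P-symbol, and the most recent letter with value
in the support of a tree of the P-symbol is the label of its root. -/
theorem omega_eq_support {W : Word} (hW : W.Nodup) :
    (∀ x, x ∈ omega W ↔ ∃ T ∈ pSymbol W, x ∈ T.support) ∧
      ∀ T ∈ pSymbol W, W.reverse.find? (fun b => decide (b.val ∈ T.support)) = some T.label := by
  induction W using List.reverseRecOn with
  | nil => simp [omega_nil, pSymbol]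
  | append_singleton W a ih =>
    have hW' := (List.nodup_append.1 hW).1
    obtain ⟨ih1, ih2⟩ := ih hW'
    obtain ⟨h1, h2⟩ := pSymbol_wf hW'
    have ha : a ∉ forestLabels (pSymbol W) := by
      rw [h2.mem_iff]
      have := (List.perm_append_singleton a W).nodup_iff.1 hW
      exact (List.nodup_cons.1 this).1
    have hspot : parkingSpot (omega W) W.reverse a = (pSymbol W).newPos a := by
      rw [parkingSpot, IndexedForest.newPos]
      cases hat : (pSymbol W).treeAt a.val with
      | none =>
        rw [dif_neg]
        rw [ih1]
        rintro ⟨T, hT, h⟩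
        exact treeAt_eq_none.1 hat T hT h
      | some T =>
        obtain ⟨hT, hTa⟩ := treeAt_eq_some hat
        have hlt := T.start_lt_endPos
        have hTa' := IndexedTree.mem_support.1 hTa
        rw [dif_pos ((ih1 _).2 ⟨T, hT, hTa⟩)]
        have hb : block (omega W) a.val = T.support := by
          ext x
          rw [block, Finset.mem_filter, IndexedTree.mem_support]
          have hout : ∀ i, (T.start - 1 ≤ i ∧ i ≤ T.endPos) → i ∈ omega W → i ∈ T.support := by
            intro i hi hio
            obtain ⟨T', hT', hi'⟩ := (ih1 i).1 hio
            rwa [h1.separated.eq_of_mem hT hT' hi hi']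
          constructor
          · rintro ⟨-, hx⟩
            by_contra hcon
            rcases (show x < T.start ∨ T.endPos ≤ x by omega) with h | h
            · have := hout (T.start - 1) (by omega) (hx (by rw [Finset.mem_uIcc]; omega))
              rw [IndexedTree.mem_support] at this
              omega
            · have := hout T.endPos (by omega) (hx (by rw [Finset.mem_uIcc]; omega))
              rw [IndexedTree.mem_support] at this
              omega
          · intro hx
            refine ⟨(ih1 x).2 ⟨T, hT, IndexedTree.mem_support.2 hx⟩, fun z hz => ?_⟩
            refine (ih1 z).2 ⟨T, hT, IndexedTree.mem_support.2 ?_⟩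
            rw [Finset.mem_uIcc] at hz
            omega
        have hmin : ∀ h, (block (omega W) a.val).min' h = T.start := by
          intro h
          refine le_antisymm (Finset.min'_le _ _ ?_) (Finset.le_min' _ _ _ fun y hy => ?_)
          · rw [hb, IndexedTree.mem_support]
            omega
          · rw [hb, IndexedTree.mem_support] at hy
            exact hy.1
        have hmax : ∀ h, (block (omega W) a.val).max' h = T.endPos - 1 := by
          intro h
          refine le_antisymm (Finset.max'_le _ _ _ fun y hy => ?_) (Finset.le_max' _ _ ?_)
          · rw [hb, IndexedTree.mem_support] at hy
            omega
          · rw [hb, IndexedTree.mem_support]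
            omega
        have hf := ih2 T hT
        rw [← hb] at hf
        simp only [hf]
        split_ifs
        · exact congrArg (· - 1) (hmin _)
        · exact (congrArg (· + 1) (hmax _)).trans (sub_add_cancel _ _)
    obtain ⟨F₁, u, F₂, h3, rfl, hpos, h4, h5⟩ := exists_insertLetter_eq h1 ha
    obtain ⟨-, -, h6, h7, -⟩ := separated_append_cons.1 h5.separated
    have hu := u.endPos_eq
    have hr : u.rootPos = u.start + u.left.numNodes := rfl
    rw [pSymbol_concat, h4]
    constructor
    · intro x
      rw [omega_concat, Finset.mem_insert, hspot, hpos, ih1, h3]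
      have hx : x ∈ u.support ↔ x = u.rootPos ∨ ∃ T ∈ u.children, x ∈ T.support := by
        constructor
        · intro hx
          have hx := IndexedTree.mem_support.1 hx
          rcases lt_trichotomy x u.rootPos with h | h | h
          · cases hl : u.left with
            | nil =>
              rw [hl] at hr
              simp only [BinaryTree.numNodes] at hr
              omega
            | node b l r =>
              refine Or.inr ⟨⟨u.start, b, l, r⟩, IndexedTree.mem_children.2 (Or.inl ⟨rfl, hl.symm⟩),
                IndexedTree.mem_support.2 ⟨hx.1, ?_⟩⟩
              rw [hr, hl] at h
              exact h
          · exact Or.inl h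
          · cases hl : u.right with
            | nil =>
              rw [hl] at hu
              simp only [BinaryTree.numNodes] at hu
              omega
            | node b l r =>
              refine Or.inr ⟨⟨u.rootPos + 1, b, l, r⟩,
                IndexedTree.mem_children.2 (Or.inr ⟨rfl, hl.symm⟩),
                IndexedTree.mem_support.2 ⟨h, ?_⟩⟩
              have : IndexedTree.endPos ⟨u.rootPos + 1, b, l, r⟩ = u.endPos := by
                rw [IndexedTree.endPos, IndexedTree.toTree, ← hl]
                dsimp only
                omega
              omega
        · rintro (h | ⟨T, hT, h⟩)
          · exact IndexedTree.mem_support.2 (by omega)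
          · have := IndexedTree.bounds_of_mem_children hT
            have := IndexedTree.mem_support.1 h
            exact IndexedTree.mem_support.2 (by omega)
      simp only [List.mem_append, List.mem_cons, or_and_right, exists_or, exists_eq_left, hx]
      rw [or_left_comm, or_assoc]
    · obtain ⟨hua, -⟩ := h5.tree u (by simp)
      have hua' : u.label.val ∈ u.support := IndexedTree.mem_support.2 (by omega)
      intro T hT
      rw [List.reverse_append, List.reverse_singleton, List.singleton_append]
      by_cases hTu : T = u
      · subst hTu
        exact List.find?_cons_of_pos (by simpa using hua')
      · rw [List.find?_cons_of_neg]
        · refine ih2 T ?_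
          rw [h3]
          simp only [List.mem_append, List.mem_cons] at hT ⊢
          tauto
        · have hua'' := IndexedTree.mem_support.1 hua'
          simp only [decide_eq_true_eq]
          intro h
          exact hTu (h5.separated.eq_of_mem (T := u) (by simp) hT (by omega) h).symm

end LabeledForests

/-! ### Slide polynomials summed over a class of words -/

noncomputable section SlideSums

variable {R : Type*} [CommRing R]

/-- The strict order on pairs of an integer and a letter in which larger integers come first, and
pairs with equal integers are ordered by their letters. A sequence is compatible with an injective
word if and only if the pairs of its entries with the letters of the word are increasing. -/
def Precedes (p q : ℤ × Letter) : Prop := q.1 < p.1 ∨ q.1 = p.1 ∧ p.2 < q.2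

instance : DecidableRel Precedes := fun p q =>
  inferInstanceAs (Decidable (q.1 < p.1 ∨ q.1 = p.1 ∧ p.2 < q.2))

theorem Precedes.trans {p q r : ℤ × Letter} (h : Precedes p q) (h' : Precedes q r) :
    Precedes p r := by
  rcases h with h | ⟨h, h1⟩ <;> rcases h' with h' | ⟨h', h2⟩
  · exact Or.inl (h'.trans h)
  · exact Or.inl (h'.trans_lt h)
  · exact Or.inl (h'.trans_eq h)
  · exact Or.inr ⟨h'.trans h, h1.trans h2⟩

theorem Precedes.asymm {p q : ℤ × Letter} (h : Precedes p q) : ¬ Precedes q p := by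
  rintro (h' | ⟨h', h2⟩) <;> rcases h with h | ⟨h, h1⟩
  · exact h.not_gt h'
  · exact h'.ne' h
  · exact h.ne' h'
  · exact h1.not_gt h2

theorem precedes_or_of_ne {p q : ℤ × Letter} (h : p.2 ≠ q.2) : Precedes p q ∨ Precedes q p := by
  rcases lt_trichotomy p.1 q.1 with h1 | h1 | h1
  · exact Or.inr (Or.inl h1)
  · rcases h.lt_or_gt with h2 | h2
    · exact Or.inl (Or.inr ⟨h1.symm, h2⟩)
    · exact Or.inr (Or.inr ⟨h1, h2⟩)
  · exact Or.inl (Or.inl h1)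

/-- The slide polynomial of a word, evaluated at `y`, with the additional condition that the last
pair of entry and letter precedes a given pair. The word is given in reverse, so that the
recursion removes its last letter. -/
def chainSum (y : ℤ → R) : List Letter → ℤ × Letter → R
  | [], _ => 1
  | a :: V, κ => ∑ u ∈ (Finset.Icc 1 a.val).filter fun u => Precedes (u, a) κ,
      y u * chainSum y V (u, a)

/-- The sequences that `chainSum` sums over. -/
def chainSet (V : List Letter) (κ : ℤ × Letter) : Finset (Fin V.length → ℤ) :=
  (Fintype.piFinset fun j : Fin V.length => Finset.Icc (1 : ℤ) (V.get j).val).filter fun a =>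
    (∀ j : Fin V.length, j.val = 0 → Precedes (a j, V.get j) κ) ∧
    ∀ i j : Fin V.length, i.val + 1 = j.val → Precedes (a j, V.get j) (a i, V.get i)

theorem mem_chainSet {V : List Letter} {κ : ℤ × Letter} {a : Fin V.length → ℤ} :
    a ∈ chainSet V κ ↔ (∀ j, 1 ≤ a j ∧ a j ≤ (V.get j).val) ∧
      (∀ j : Fin V.length, j.val = 0 → Precedes (a j, V.get j) κ) ∧
      ∀ i j : Fin V.length, i.val + 1 = j.val → Precedes (a j, V.get j) (a i, V.get i) := by
  simp [chainSet]

theorem cons_mem_chainSet {b : Letter} {V : List Letter} {κ : ℤ × Letter}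
    {a : Fin (V.length + 1) → ℤ} :
    (show Fin (b :: V).length → ℤ from a) ∈ chainSet (b :: V) κ ↔
      ((1 ≤ a 0 ∧ a 0 ≤ b.val) ∧ Precedes (a 0, b) κ) ∧
      (fun j : Fin V.length => a j.succ) ∈ chainSet V (a 0, b) := by
  rw [mem_chainSet, mem_chainSet]
  constructor
  · rintro ⟨h1, h2, h3⟩
    exact ⟨⟨h1 (0 : Fin (V.length + 1)), h2 (0 : Fin (V.length + 1)) rfl⟩,
      fun j => h1 j.succ, fun j hj => h3 (0 : Fin (V.length + 1)) j.succ (by simp [hj]),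
      fun i j hij => h3 i.succ j.succ (by simp [hij])⟩
  · rintro ⟨⟨h1, h2⟩, h3, h4, h5⟩
    refine ⟨fun j => ?_, fun j hj => ?_, fun i j hij => ?_⟩
    · exact Fin.cases (motive := fun j : Fin (V.length + 1) =>
        1 ≤ a j ∧ a j ≤ ((b :: V).get j).val) h1 h3 j
    · obtain rfl : j = (0 : Fin (V.length + 1)) := Fin.ext hj
      exact h2
    · revert hij
      refine Fin.cases (motive := fun j : Fin (V.length + 1) =>
        i.val + 1 = j.val → Precedes (a j, (b :: V).get j) (a i, (b :: V).get i)) ?_ ?_ j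
      · intro h
        simp at h
      · intro j
        refine Fin.cases (motive := fun i : Fin (V.length + 1) =>
          i.val + 1 = j.succ.val →
            Precedes (a j.succ, (b :: V).get j.succ) (a i, (b :: V).get i)) ?_ ?_ i
        · intro h
          exact h4 j (by simpa using h.symm)
        · intro i h
          exact h5 i j (by simpa using h)

theorem chainSum_eq_sum (y : ℤ → R) (V : List Letter) (κ : ℤ × Letter) :
    chainSum y V κ = ∑ a ∈ chainSet V κ, ∏ j, y (a j) := by
  induction V generalizing κ with
  | nil =>
    have : chainSet [] κ = {fun j => 0} := by
      ext a
      simp only [mem_chainSet, Finset.mem_singleton]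
      exact ⟨fun _ => funext fun j => j.elim0, fun _ => ⟨fun j => j.elim0, fun j => j.elim0,
        fun j => j.elim0⟩⟩
    simp [chainSum, this]
  | cons b V ih =>
    simp only [chainSum, ih, Finset.mul_sum]
    rw [Finset.sum_sigma']
    refine Finset.sum_bij'
      (fun x _ => show Fin (b :: V).length → ℤ from
        (Fin.cons x.1 x.2 : Fin (V.length + 1) → ℤ))
      (fun a _ => ⟨(show Fin (V.length + 1) → ℤ from a) 0,
        fun j : Fin V.length => (show Fin (V.length + 1) → ℤ from a) j.succ⟩) ?_ ?_ ?_ ?_ ?_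
    · rintro ⟨u, a⟩ h
      simp only [Finset.mem_sigma, Finset.mem_filter, Finset.mem_Icc] at h
      exact cons_mem_chainSet.2 h
    · intro a h
      simp only [Finset.mem_sigma, Finset.mem_filter, Finset.mem_Icc]
      exact cons_mem_chainSet.1 h
    · rintro ⟨u, a⟩ _
      rfl
    · intro a _
      exact Fin.cons_self_tail (show Fin (V.length + 1) → ℤ from a)
    · rintro ⟨u, a⟩ _
      exact (Fin.prod_univ_succ fun j => y ((Fin.cons u a : Fin (V.length + 1) → ℤ) j)).symm

/-- The slide polynomial of an injective word; the bound is void because the entries of compatible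
sequences are positive. -/
theorem slide_eq_chainSum {W : Word} (hW : W.Nodup) (c : Letter) :
    slide W = chainSum MvPolynomial.X W.reverse (0, c) := by
  rw [chainSum_eq_sum, slide]
  let e : Fin W.length ≃ Fin W.reverse.length :=
    Fin.revPerm.trans (finCongr List.length_reverse.symm)
  have he : ∀ i, (e i).val = W.length - (i.val + 1) := fun i => by simp [e, Fin.val_rev]
  have hget : ∀ i, W.reverse.get (e i) = W.get i := by
    intro i
    simp only [List.get_eq_getElem, List.getElem_reverse, he]
    congr 1
    omega
  refine Finset.sum_equiv (Equiv.arrowCongr e (Equiv.refl ℤ)) (fun a => ?_) fun a _ => ?_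
  · rw [mem_compatible, mem_chainSet]
    simp only [e.surjective.forall, hget, Equiv.arrowCongr_apply, Function.comp_apply,
      Equiv.symm_apply_apply, Equiv.refl_apply, he]
    refine and_congr_right fun h => ?_
    have hfirst : ∀ j : Fin W.length, Precedes (a j, W.get j) (0, c) :=
      fun j => Or.inl (by have := (h j).1; dsimp only; omega)
    simp only [hfirst, implies_true, true_and]
    rw [forall_comm]
    refine forall_congr' fun j => forall_congr' fun i => ?_
    have hidx : i.val + 1 = j.val ↔ W.length - (j.val + 1) + 1 = W.length - (i.val + 1) := by
      have := i.isLt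
      have := j.isLt
      omega
    rw [← hidx]
    refine imp_congr_right fun hij => ?_
    have hne : W.get i ≠ W.get j := fun h => by
      have := (List.nodup_iff_injective_get.1 hW) h
      rw [this] at hij
      omega
    simp only [Precedes]
    constructor
    · rintro ⟨h1, h2⟩
      rcases h1.lt_or_eq with h1 | h1
      · exact Or.inl h1
      · exact Or.inr ⟨h1, hne.lt_or_gt.resolve_right fun h3 => (h2 h3).ne h1⟩
    · rintro (h1 | ⟨h1, h2⟩)
      · exact ⟨h1.le, fun _ => h1⟩
      · exact ⟨h1.le, fun h3 => absurd h3 h2.not_gt⟩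
  · exact Fintype.prod_equiv e _ _ fun i => by simp

theorem map_chainSum {S : Type*} [CommRing S] (φ : R →+* S) (y : ℤ → R) (V : List Letter)
    (κ : ℤ × Letter) : φ (chainSum y V κ) = chainSum (fun j => φ (y j)) V κ := by
  induction V generalizing κ with
  | nil => simp [chainSum]
  | cons a V ih => simp [chainSum, ih]

/-- A double sum over pairs that precede `κ` is split according to which of the two comes first. -/
theorem sum_sum_precedes {a b : Letter} (hab : a ≠ b) (I J : Finset ℤ) (κ : ℤ × Letter)
    (F : ℤ → ℤ → R) :
    ∑ u ∈ I.filter (fun u => Precedes (u, a) κ), ∑ v ∈ J.filter (fun v => Precedes (v, b) κ),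
      F u v =
    ∑ u ∈ I.filter (fun u => Precedes (u, a) κ), ∑ v ∈ J.filter (fun v => Precedes (v, b) (u, a)),
      F u v +
    ∑ v ∈ J.filter (fun v => Precedes (v, b) κ), ∑ u ∈ I.filter (fun u => Precedes (u, a) (v, b)),
      F u v := by
  have h3 : ∑ v ∈ J.filter (fun v => Precedes (v, b) κ),
      ∑ u ∈ I.filter (fun u => Precedes (u, a) (v, b)), F u v =
      ∑ u ∈ I, ∑ v ∈ J, if Precedes (v, b) κ then
        if Precedes (u, a) (v, b) then F u v else 0 else 0 := by
    rw [Finset.sum_comm, Finset.sum_filter]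
    refine Finset.sum_congr rfl fun v _ => ?_
    split_ifs
    · rw [Finset.sum_filter]
    · simp
  rw [h3, Finset.sum_filter, Finset.sum_filter, ← Finset.sum_add_distrib]
  refine Finset.sum_congr rfl fun u _ => ?_
  have h4 : ∀ c : Prop, ∀ _ : Decidable c, ∀ f : ℤ → R,
      (if c then ∑ v ∈ J, f v else 0) = ∑ v ∈ J, if c then f v else 0 := by
    intro c _ f
    split_ifs <;> simp
  rw [Finset.sum_filter, Finset.sum_filter, h4, h4, ← Finset.sum_add_distrib]
  refine Finset.sum_congr rfl fun v _ => ?_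
  rcases precedes_or_of_ne (p := (u, a)) (q := (v, b)) hab with h | h
  · simp only [h, h.asymm, if_true, if_false, ite_self, zero_add]
    by_cases h5 : Precedes (v, b) κ
    · simp [h5, h.trans h5]
    · simp [h5]
  · simp only [h, h.asymm, if_true, if_false, ite_self, add_zero]
    by_cases h5 : Precedes (u, a) κ
    · simp [h5, h.trans h5]
    · simp [h5]

/-- A product of sums over pairs that precede `κ`, expanded according to the last of the chosen
pairs. -/
theorem prod_sum_precedes {ι : Type*} [DecidableEq ι] (s : Finset ι) (hs : s.Nonempty)
    (lab : ι → Letter) (hlab : Set.InjOn lab s) (I : ι → Finset ℤ) (φ : ι → ℤ → R)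
    (κ : ℤ × Letter) :
    ∏ i ∈ s, ∑ u ∈ (I i).filter (fun u => Precedes (u, lab i) κ), φ i u =
      ∑ i ∈ s, ∑ u ∈ (I i).filter (fun u => Precedes (u, lab i) κ), φ i u *
        ∏ j ∈ s.erase i, ∑ v ∈ (I j).filter (fun v => Precedes (v, lab j) (u, lab i)), φ j v := by
  induction hs using Finset.Nonempty.cons_induction generalizing κ with
  | singleton i => simp
  | cons i s hi hs ih =>
    have ih := ih (hlab.mono (by simp))
    rw [Finset.prod_cons, Finset.sum_cons, Finset.erase_cons]
    have h1 : ∀ j ∈ s, (Finset.cons i s hi).erase j = Finset.cons i (s.erase j) (by simp [hi]) := by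
      intro j hj
      have hij : i ≠ j := by
        rintro rfl
        exact hi hj
      ext x
      simp only [Finset.mem_erase, Finset.mem_cons]
      constructor
      · tauto
      · rintro (rfl | h)
        · exact ⟨hij, Or.inl rfl⟩
        · exact ⟨h.1, Or.inr h.2⟩
    have h2 : ∀ j ∈ s, lab i ≠ lab j := by
      intro j hj h
      have := hlab (by simp) (by simp [hj]) h
      exact hi (this ▸ hj)
    simp only [ih]
    rw [Finset.mul_sum]
    simp only [Finset.mul_sum]
    rw [Finset.sum_comm, ← Finset.sum_add_distrib]
    refine Finset.sum_congr rfl fun j hj => ?_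
    simp only [h1 j hj, Finset.prod_cons]
    rw [← Finset.mul_sum, Finset.sum_mul_sum, sum_sum_precedes (h2 j hj)]
    congr 1
    refine Finset.sum_congr rfl fun v _ => ?_
    rw [Finset.sum_mul, Finset.mul_sum]
    exact Finset.sum_congr rfl fun u _ => by ring

/-- The forest polynomial of a labeled tree, as a generating function of bounded partitions: the
pair at each node precedes the pair at its parent, the pair at the root precedes `κ`, and the
integer at a node is at most the value of its letter. -/
def labelSum (y : ℤ → R) : BinaryTree Letter → ℤ × Letter → R
  | .nil, _ => 1
  | .node a l r, κ => ∑ u ∈ (Finset.Icc 1 a.val).filter fun u => Precedes (u, a) κ,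
      y u * (labelSum y l (u, a) * labelSum y r (u, a))

/-- For a well-formed tree, the values of the letters may be replaced by the first positions of
the subtrees. -/
theorem labelSum_eq_treeSum (y : ℤ → R) (T : BinaryTree Letter) (s : ℤ) (hT : TreeWF T s)
    (κ : ℤ × Letter) (t : ℤ) (ht : 1 ≤ t)
    (hκ : ∀ b ∈ rootLabel T, ∀ u, 1 ≤ u → (Precedes (u, b) κ ↔ t ≤ u)) :
    labelSum y T κ = treeSum y T s t := by
  induction T generalizing s κ t with
  | nil => rfl
  | node a l r ihl ihr =>
    obtain ⟨⟨h1, h2⟩, h3, h4, h5, h6⟩ := hT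
    have h7 : (Finset.Icc 1 a.val).filter (fun u => Precedes (u, a) κ) = Finset.Icc t a.val := by
      ext u
      rw [Finset.mem_filter, Finset.mem_Icc, Finset.mem_Icc]
      constructor
      · rintro ⟨h8, h9⟩
        exact ⟨(hκ a rfl u h8.1).1 h9, h8.2⟩
      · rintro ⟨h8, h9⟩
        exact ⟨⟨by omega, h9⟩, (hκ a rfl u (by omega)).2 h8⟩
    rw [labelSum, treeSum, h7,
      ← Finset.sum_subset (Finset.Icc_subset_Icc_right (a := t) h1)]
    · refine Finset.sum_congr rfl fun u hu => ?_
      have hu := Finset.mem_Icc.1 hu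
      rw [ihl s h5 (u, a) u (by omega), ihr _ h6 (u, a) (u + 1) (by omega)]
      · intro b hb v
        have := (h4 b hb).not_gt
        simp only [Precedes, this, and_false, or_false]
        omega
      · intro b hb v _
        have := h3 b hb
        simp only [Precedes, this, and_true]
        omega
    · intro u hu hu'
      simp only [Finset.mem_Icc] at hu hu'
      have e1 : labelSum y l (u, a) = treeSum y l s u := by
        refine ihl s h5 (u, a) u (by omega) fun b hb v _ => ?_
        have := h3 b hb
        simp only [Precedes, this, and_true]
        omega
      have e2 : labelSum y r (u, a) = treeSum y r (s + l.numNodes + 1) (u + 1) := by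
        refine ihr _ h6 (u, a) (u + 1) (by omega) fun b hb v _ => ?_
        have := (h4 b hb).not_gt
        simp only [Precedes, this, and_false, or_false]
        omega
      rw [e1, e2]
      by_cases hl : l = .nil
      · subst hl
        by_cases hr : r = .nil
        · subst hr
          simp only [BinaryTree.numNodes] at h2
          omega
        · rw [treeSum_eq_zero y hr (by simp only [BinaryTree.numNodes]; omega), mul_zero, mul_zero]
      · rw [treeSum_eq_zero y hl (by omega), zero_mul, mul_zero]

end SlideSums

/-! ### The words with a given P-symbol -/

noncomputable section WordsOfForest

open Classical in
/-- The injective words with a given P-symbol. -/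
def forestWords (F : IndexedForest) : Finset Word :=
  ((forestLabels F).permutations.filter fun W => pSymbol W = F).toFinset

theorem mem_forestWords {F : IndexedForest} (hF : ForestWF F) {W : Word} :
    W ∈ forestWords F ↔ W.Nodup ∧ pSymbol W = F := by
  simp only [forestWords, List.mem_toFinset, List.mem_filter, List.mem_permutations,
    decide_eq_true_eq]
  constructor
  · rintro ⟨h1, h2⟩
    exact ⟨h1.nodup_iff.2 hF.nodup, h2⟩
  · rintro ⟨h1, rfl⟩
    exact ⟨(pSymbol_wf h1).2.symm, rfl⟩

open Classical in
/-- The forest obtained from `F` by removing the root of the tree `T`. -/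
def removeRoot (F : IndexedForest) (T : IndexedTree) : IndexedForest :=
  F.flatMap fun T' => if T' = T then T.children else [T']

theorem Separated.nodup {F : IndexedForest} (hF : Separated F) : F.Nodup :=
  hF.imp fun {T T'} h => by
    rintro rfl
    have := T.start_lt_endPos
    omega

theorem removeRoot_eq {F₁ F₂ : IndexedForest} {T : IndexedTree} (h : (F₁ ++ T :: F₂).Nodup) :
    removeRoot (F₁ ++ T :: F₂) T = F₁ ++ (T.children ++ F₂) := by
  classical
  have key : ∀ F : IndexedForest, T ∉ F →
      F.flatMap (fun T' => if T' = T then T.children else [T']) = F := by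
    intro F hF
    induction F with
    | nil => rfl
    | cons T' F ih =>
      rw [List.flatMap_cons, if_neg (by rintro rfl; simp at hF), ih fun h => hF (by simp [h])]
      rfl
  have h' := List.nodup_middle.1 h
  have hT : T ∉ F₁ ++ F₂ := (List.nodup_cons.1 h').1
  rw [List.mem_append, not_or] at hT
  rw [removeRoot, List.flatMap_append, List.flatMap_cons, if_pos rfl]
  convert congrArg₂ (fun A B => A ++ (T.children ++ B)) (key F₁ hT.1) (key F₂ hT.2)

theorem ForestWF.injOn_label {F : IndexedForest} (hF : ForestWF F) {T T' : IndexedTree}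
    (hT : T ∈ F) (hT' : T' ∈ F) (h : T.label = T'.label) : T = T' := by
  obtain ⟨F₁, F₂, rfl⟩ := List.append_of_mem hT
  have h1 := (List.nodup_cons.1 ((forestLabels_perm F₁ F₂ T).nodup_iff.1 hF.nodup)).1
  by_contra hne
  refine h1 (List.mem_flatMap.2 ⟨T', ?_, by simp [h, IndexedTree.toTree, treeLabels]⟩)
  simp only [List.mem_append, List.mem_cons] at hT' ⊢
  have hne' := Ne.symm hne
  tauto

/-- The last letter of a word is the label of a root of its P-symbol, and the word without it runs
through the words whose P-symbol is the forest without that root. -/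
theorem sum_forestWords {M : Type*} [AddCommMonoid M] {F : IndexedForest} (hF : ForestWF F)
    (hne : F ≠ []) (h : Word → M) [DecidableEq IndexedTree] :
    ∑ W ∈ forestWords F, h W =
      ∑ T ∈ F.toFinset, ∑ W ∈ forestWords (removeRoot F T), h (W ++ [T.label]) := by
  rw [Finset.sum_sigma']
  symm
  have hwf : ∀ T ∈ F, ForestWF (removeRoot F T) := by
    intro T hT
    obtain ⟨F₁, F₂, rfl⟩ := List.append_of_mem hT
    rw [removeRoot_eq hF.separated.nodup]
    exact hF.replace_children
  refine Finset.sum_bij (fun x _ => x.2 ++ [x.1.label]) ?_ ?_ ?_ fun _ _ => rfl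
  · rintro ⟨T, W⟩ hx
    simp only [Finset.mem_sigma, List.mem_toFinset] at hx
    obtain ⟨hT, hW⟩ := hx
    obtain ⟨hW1, hW2⟩ := (mem_forestWords (hwf T hT)).1 hW
    rw [mem_forestWords hF]
    have hperm := (pSymbol_wf hW1).2
    rw [hW2] at hperm
    rw [pSymbol_concat, hW2]
    obtain ⟨F₁, F₂, rfl⟩ := List.append_of_mem hT
    rw [removeRoot_eq hF.separated.nodup] at hperm ⊢
    refine ⟨?_, insertLetter_children hF⟩
    rw [(List.perm_append_singleton _ _).nodup_iff, ← (hperm.cons _).nodup_iff]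
    exact (forestLabels_perm F₁ F₂ T).nodup_iff.1 hF.nodup
  · rintro ⟨T, W⟩ hx ⟨T', W'⟩ hx' heq
    simp only [Finset.mem_sigma, List.mem_toFinset] at hx hx'
    obtain ⟨h1, h2⟩ := List.append_inj' heq rfl
    obtain rfl := hF.injOn_label hx.1 hx'.1 (List.singleton_inj.1 h2)
    obtain rfl : W = W' := h1
    rfl
  · intro W hW
    obtain ⟨hW1, hW2⟩ := (mem_forestWords hF).1 hW
    rcases List.eq_nil_or_concat' W with rfl | ⟨W', a, rfl⟩
    · exact absurd hW2.symm hne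
    · have hW' := (List.nodup_append.1 hW1).1
      obtain ⟨h1, h2⟩ := pSymbol_wf hW'
      have ha : a ∉ forestLabels (pSymbol W') := by
        rw [h2.mem_iff]
        have := (List.perm_append_singleton a W').nodup_iff.1 hW1
        exact (List.nodup_cons.1 this).1
      obtain ⟨F₁, u, F₂, h3, rfl, -, h4, h5⟩ := exists_insertLetter_eq h1 ha
      rw [pSymbol_concat, h4] at hW2
      subst hW2
      refine ⟨⟨u, W'⟩, ?_, rfl⟩
      simp only [Finset.mem_sigma, List.mem_toFinset]
      refine ⟨by simp, (mem_forestWords (hwf u (by simp))).2 ⟨hW', ?_⟩⟩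
      rw [h3, removeRoot_eq h5.separated.nodup]

theorem prod_map_placeTree {M : Type*} [CommMonoid M] (g : BinaryTree Letter → M)
    (hg : g .nil = 1) (s : ℤ) (t : BinaryTree Letter) :
    ((placeTree s t).map fun T => g T.toTree).prod = g t := by
  cases t with
  | nil => simp [placeTree, hg]
  | node a l r => simp [placeTree, IndexedTree.toTree]

theorem prod_map_removeRoot {M : Type*} [CommMonoid M] [DecidableEq IndexedTree]
    (g : BinaryTree Letter → M) (hg : g .nil = 1) {F : IndexedForest} (hF : F.Nodup)
    {T : IndexedTree} (hT : T ∈ F) : ((removeRoot F T).map fun T' => g T'.toTree).prod =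
      g T.left * g T.right * ∏ T' ∈ F.toFinset.erase T, g T'.toTree := by
  obtain ⟨F₁, F₂, rfl⟩ := List.append_of_mem hT
  have hnd := List.nodup_cons.1 (List.nodup_middle.1 hF)
  have h1 : (F₁ ++ T :: F₂).toFinset.erase T = (F₁ ++ F₂).toFinset := by
    ext x
    simp only [Finset.mem_erase, List.mem_toFinset, List.mem_append, List.mem_cons]
    constructor
    · tauto
    · intro h
      refine ⟨?_, by tauto⟩
      rintro rfl
      exact hnd.1 (List.mem_append.2 h)
  rw [removeRoot_eq hF, h1, List.prod_toFinset _ hnd.2, IndexedTree.children]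
  simp only [List.map_append, List.prod_append, prod_map_placeTree g hg]
  rw [mul_left_comm, ← mul_assoc]

theorem length_treeLabels (t : BinaryTree Letter) : (treeLabels t).length = t.numNodes := by
  induction t with
  | nil => rfl
  | node a l r ihl ihr => simp [treeLabels, BinaryTree.numNodes, ihl, ihr]

theorem length_removeRoot {F : IndexedForest} (hF : ForestWF F) {T : IndexedTree} (hT : T ∈ F) :
    ForestWF (removeRoot F T) ∧
      (forestLabels (removeRoot F T)).length + 1 = (forestLabels F).length := by
  obtain ⟨F₁, F₂, rfl⟩ := List.append_of_mem hT
  rw [removeRoot_eq hF.separated.nodup, (forestLabels_perm F₁ F₂ T).length_eq]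
  exact ⟨hF.replace_children, rfl⟩

theorem eq_nil_of_length_forestLabels {F : IndexedForest} (h : (forestLabels F).length = 0) :
    F = [] := by
  cases F with
  | nil => rfl
  | cons T F => simp [forestLabels, IndexedTree.toTree, treeLabels] at h

theorem forestWords_nil : forestWords [] = {[]} := by
  ext W
  rw [mem_forestWords forestWF_nil, Finset.mem_singleton]
  constructor
  · rintro ⟨h1, h2⟩
    have := (pSymbol_wf h1).2
    rw [h2] at this
    exact this.symm.eq_nil
  · rintro rfl
    exact ⟨List.nodup_nil, rfl⟩

/-- The sum of the slide polynomials over the words with a given P-symbol is a product over the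
trees of the P-symbol. -/
theorem sum_chainSum_forestWords {R : Type*} [CommRing R] (y : ℤ → R) {F : IndexedForest}
    (hF : ForestWF F) (κ : ℤ × Letter) : ∑ W ∈ forestWords F, chainSum y W.reverse κ =
      (F.map fun T => labelSum y T.toTree κ).prod := by
  classical
  induction hn : (forestLabels F).length generalizing F κ with
  | zero =>
    obtain rfl := eq_nil_of_length_forestLabels hn
    simp [forestWords_nil, chainSum]
  | succ n ih =>
    have hne : F ≠ [] := by
      rintro rfl
      simp [forestLabels] at hn
    rw [sum_forestWords hF hne, ← List.prod_toFinset _ hF.separated.nodup]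
    refine Eq.trans ?_ (prod_sum_precedes F.toFinset (by simpa using hne) IndexedTree.label
      (fun T hT T' hT' => hF.injOn_label (by simpa using hT) (by simpa using hT'))
      (fun T => Finset.Icc 1 T.label.val)
      (fun T u => y u * (labelSum y T.left (u, T.label) * labelSum y T.right (u, T.label))) κ).symm
    refine Finset.sum_congr rfl fun T hT => ?_
    have hT := List.mem_toFinset.1 hT
    obtain ⟨h1, h2⟩ := length_removeRoot hF hT
    simp only [List.reverse_append, List.reverse_singleton, List.singleton_append, chainSum]
    rw [Finset.sum_comm]
    refine Finset.sum_congr rfl fun u _ => ?_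
    rw [← Finset.mul_sum, ih h1 _ (by omega),
      prod_map_removeRoot (fun t => labelSum y t (u, T.label)) rfl hF.separated.nodup hT, ← mul_assoc]
    rfl

/-- The number of words with a given P-symbol is given by the hook length formula for forests. -/
theorem card_forestWords {F : IndexedForest} (hF : ForestWF F) :
    ((forestWords F).card : ℚ) =
      (forestLabels F).length.factorial * (F.map fun T => hookWeight T.toTree).prod := by
  classical
  induction hn : (forestLabels F).length generalizing F with
  | zero =>
    obtain rfl := eq_nil_of_length_forestLabels hn
    simp [forestWords_nil]
  | succ n ih =>
    have hne : F ≠ [] := by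
      rintro rfl
      simp [forestLabels] at hn
    have hnd := hF.separated.nodup
    have h0 : ((forestWords F).card : ℚ) = ∑ W ∈ forestWords F, 1 := by simp
    have key : ∀ T ∈ F.toFinset, ∑ W ∈ forestWords (removeRoot F T), (1 : ℚ) =
        T.toTree.numNodes * (n.factorial * ∏ T ∈ F.toFinset, hookWeight T.toTree) := by
      intro T hT
      obtain ⟨h1, h2⟩ := length_removeRoot hF (List.mem_toFinset.1 hT)
      rw [Finset.sum_const, nsmul_one, ih h1 (by omega),
        prod_map_removeRoot hookWeight rfl hnd (List.mem_toFinset.1 hT),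
        ← Finset.mul_prod_erase _ _ hT]
      have h3 : (T.left.numNodes + T.right.numNodes + 1 : ℚ) ≠ 0 := by positivity
      rw [IndexedTree.numNodes_toTree, IndexedTree.toTree, hookWeight]
      push_cast
      field_simp
    have h4 : ∑ T ∈ F.toFinset, T.toTree.numNodes = n + 1 := by
      rw [List.sum_toFinset _ hnd, ← hn, forestLabels, List.length_flatMap]
      simp only [length_treeLabels]
    rw [h0, sum_forestWords hF hne, Finset.sum_congr rfl key, ← Finset.sum_mul, ← Nat.cast_sum, h4,
      List.prod_toFinset _ hnd, Nat.factorial_succ]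
    push_cast
    ring

end WordsOfForest

/-! ### Divided symmetrization of the polynomial of a class -/

section Main

/-- The trees of a labeled forest with their first positions. -/
def IndexedForest.placed (F : IndexedForest) : List (ℤ × BinaryTree Letter) :=
  F.map fun T => (T.start, T.toTree)

theorem sum_forestWords_chainSum_eq_forestSum {R : Type*} [CommRing R] (y : ℤ → R)
    {F : IndexedForest} (hF : ForestWF F) (c : Letter) :
    ∑ W ∈ forestWords F, chainSum y W.reverse (0, c) = forestSum y F.placed := by
  rw [sum_chainSum_forestWords y hF, forestSum, IndexedForest.placed, List.map_map]
  refine congrArg List.prod (List.map_congr_left fun T hT => ?_)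
  refine labelSum_eq_treeSum y _ _ (hF.tree T hT) _ 1 le_rfl fun b _ u hu => ?_
  simp only [Precedes]
  omega

theorem forestSize_placed (F : IndexedForest) :
    forestSize F.placed = (forestLabels F).length := by
  rw [forestSize, IndexedForest.placed, List.map_map, forestLabels, List.length_flatMap]
  simp only [length_treeLabels, Function.comp_def]

theorem forestSize_placed_cons (T : IndexedTree) (F : IndexedForest) :
    forestSize (IndexedForest.placed (T :: F)) = T.toTree.numNodes + forestSize F.placed := by
  simp [forestSize, IndexedForest.placed]

theorem Separated.forestSize_le {F : IndexedForest} (hF : Separated F) {a b : ℤ} (hab : a ≤ b)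
    (h : ∀ T ∈ F, a ≤ T.start ∧ T.endPos ≤ b) : (forestSize F.placed : ℤ) ≤ b - a := by
  induction F generalizing a with
  | nil => simpa [forestSize, IndexedForest.placed] using hab
  | cons T F ih =>
    obtain ⟨h1, h2⟩ := List.pairwise_cons.1 hF
    have h3 := h T (by simp)
    have := ih h2 (a := T.endPos) h3.2 fun T' hT' => ⟨(h1 T' hT').le, (h T' (by simp [hT'])).2⟩
    rw [forestSize_placed_cons]
    simp only [IndexedTree.endPos] at this h3
    push_cast
    omega

/-- A separated forest with as many nodes as an interval that contains its support has at most one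
tree. -/
theorem Separated.eq_nil_or_singleton {F : IndexedForest} (hF : Separated F) {a b : ℤ}
    (h : ∀ T ∈ F, a ≤ T.start ∧ T.endPos ≤ b) (hsize : (forestSize F.placed : ℤ) = b - a) :
    F = [] ∨ ∃ T, F = [T] ∧ T.start = a ∧ T.endPos = b := by
  cases F with
  | nil => exact Or.inl rfl
  | cons T F =>
    obtain ⟨h1, h2⟩ := List.pairwise_cons.1 hF
    have h3 := h T (by simp)
    rw [forestSize_placed_cons] at hsize
    push_cast at hsize
    have hst : T.start + T.toTree.numNodes = T.endPos := rfl
    cases F with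
    | nil =>
      simp only [forestSize, IndexedForest.placed, List.map_nil, List.sum_nil] at hsize
      exact Or.inr ⟨T, rfl, by omega, by omega⟩
    | cons T' F =>
      exfalso
      have h4 := h1 T' (by simp)
      have h5 := (h T' (by simp)).2
      have h6 := T'.start_lt_endPos
      have := Separated.forestSize_le h2 (a := T.endPos + 1) (b := b) (by omega) fun T'' hT'' =>
        ⟨h1 T'' hT'', (h T'' (by simp [hT''])).2⟩
      omega

/-- The divided symmetrization of the forest polynomial of a P-symbol with `k` nodes, in `k + 1`
variables, is the number of words with this P-symbol if the support is `1, ..., k`, and zero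
otherwise. -/
theorem listSymm_forestSum_placed {K : Type*} [Field K] [CharZero K] {F : IndexedForest}
    (hF : ForestWF F) {k : ℕ} (hk : (forestLabels F).length = k) (l : List K) (hl : l.Nodup)
    (hlen : l.length = k + 1) [Decidable (∀ x, (∃ T ∈ F, x ∈ T.support) ↔ x ∈ Finset.Icc 1 (k : ℤ))] :
    listSymm (fun m => forestSum (listVal m) F.placed) l =
      if ∀ x, (∃ T ∈ F, x ∈ T.support) ↔ x ∈ Finset.Icc 1 (k : ℤ) then
        ((forestWords F).card : K) else 0 := by
  have hsize := forestSize_placed F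
  rw [hk] at hsize
  by_cases h1 : ∃ T ∈ F, T.start < 1
  · obtain ⟨T, hT, hlt⟩ := h1
    rw [if_neg, listSymm_congr (g := fun _ => 0 * 0), listSymm_const_mul, zero_mul]
    · intro m _
      rw [zero_mul]
      refine List.prod_eq_zero (List.mem_map.2 ⟨_, List.mem_map.2 ⟨T, hT, rfl⟩, ?_⟩)
      exact treeSum_eq_zero _ (by simp [IndexedTree.toTree]) hlt
    · intro h
      have := Finset.mem_Icc.1 ((h T.start).1 ⟨T, hT, IndexedTree.mem_support.2
        ⟨le_rfl, T.start_lt_endPos⟩⟩)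
      omega
  push Not at h1
  by_cases h2 : ∃ T ∈ F, (k : ℤ) + 1 < T.endPos
  · obtain ⟨T, hT, hlt⟩ := h2
    rw [if_neg]
    · refine listSymm_forestSum_of_protrudes k F.placed ?_ hsize
        ⟨_, List.mem_map.2 ⟨T, hT, rfl⟩, by simp [IndexedTree.toTree], hlt⟩ l hl hlen
      exact List.pairwise_map.2 (hF.separated.imp fun h => h.le)
    · intro h
      have := Finset.mem_Icc.1 ((h (T.endPos - 1)).1 ⟨T, hT, IndexedTree.mem_support.2
        ⟨by have := T.start_lt_endPos; omega, by omega⟩⟩)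
      omega
  push Not at h2
  have hcard : (((forestWords F).card : ℚ) : K) = ((forestWords F).card : K) := by simp
  rw [← hcard, card_forestWords hF, hk]
  rcases hF.separated.eq_nil_or_singleton (a := 1) (b := k + 1)
    (fun T hT => ⟨h1 T hT, h2 T hT⟩) (by omega) with rfl | ⟨T, rfl, h3, h4⟩
  · obtain rfl : k = 0 := by simpa [forestLabels] using hk.symm
    rw [if_pos (by intro x; simp)]
    -- The polynomial of the empty forest is that of the empty tree.
    exact listSymm_treeSum 0 (.nil : BinaryTree Letter) rfl l hl hlen
  · rw [if_pos]
    · have h5 : T.toTree.numNodes = k := by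
        simp only [IndexedTree.endPos] at h4
        omega
      have := listSymm_treeSum k T.toTree h5 l hl hlen
      simpa [forestSum, IndexedForest.placed, h3] using this
    · intro x
      simp only [List.mem_singleton, exists_eq_left, IndexedTree.mem_support, Finset.mem_Icc]
      omega

theorem isOmegaParking_iff {W : Word} (hW : W.Nodup) : IsOmegaParking W ↔
    ∀ x, (∃ T ∈ pSymbol W, x ∈ T.support) ↔ x ∈ Finset.Icc 1 (W.length : ℤ) := by
  rw [IsOmegaParking, Finset.ext_iff]
  simp only [(omega_eq_support hW).1]

theorem consecDiff_eq_prod {K : Type*} [Field K] (l : List K) :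
    consecDiff l = ∏ i ∈ Finset.range (l.length - 1), (l.getD i 0 - l.getD (i + 1) 0) := by
  induction l with
  | nil => rfl
  | cons a l ih =>
    cases l with
    | nil => rfl
    | cons b l =>
      rw [consecDiff, ih]
      simp only [List.length_cons, Nat.add_sub_cancel]
      rw [Finset.prod_range_succ']
      simp [mul_comm]

/-- The rearrangements of a list with distinct entries correspond to the permutations of its
indices. -/
theorem sum_perm_ofFn {α M : Type*} [AddCommMonoid M] {n : ℕ} (x : Fin n → α)
    (hx : Function.Injective x) (h : List α → M) :
    ∑ w : Equiv.Perm (Fin n), h (List.ofFn (x ∘ w)) = ((List.ofFn x).permutations'.map h).sum := by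
  classical
  have hnd : (List.ofFn x).permutations'.Nodup :=
    (List.permutations_perm_permutations' _).nodup_iff.1
      (List.nodup_permutations _ (List.nodup_ofFn.2 hx))
  have hinj : Function.Injective fun w : Equiv.Perm (Fin n) => List.ofFn (x ∘ w) := by
    intro w w' hw
    exact Equiv.ext fun i => hx (congrFun (List.ofFn_injective hw) i)
  have himg : Finset.univ.image (fun w : Equiv.Perm (Fin n) => List.ofFn (x ∘ w)) =
      (List.ofFn x).permutations'.toFinset := by
    refine Finset.eq_of_subset_of_card_le ?_ ?_
    · intro m hm
      obtain ⟨w, -, rfl⟩ := Finset.mem_image.1 hm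
      exact List.mem_toFinset.2 (List.mem_permutations'.2 (Equiv.Perm.ofFn_comp_perm w x))
    · rw [List.toFinset_card_of_nodup hnd, Finset.card_image_of_injective _ hinj,
        ← (List.permutations_perm_permutations' _).length_eq, List.length_permutations,
        Finset.card_univ, Fintype.card_perm]
      simp
  rw [← List.sum_toFinset _ hnd, ← himg, Finset.sum_image hinj.injOn]

section RationalFunctions

open MvPolynomial

/-- The substitution homomorphism to the field of rational functions given by a sequence. -/
noncomputable def evalRat (n : ℕ) (y : ℤ → FractionRing (MvPolynomial (Fin n) ℚ)) :
    MvPolynomial ℤ ℚ →+* FractionRing (MvPolynomial (Fin n) ℚ) :=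
  eval₂Hom ((algebraMap (MvPolynomial (Fin n) ℚ) _).comp C) y

theorem dividedSymmetrization_eq_listSymm {n : ℕ} (f : MvPolynomial (Fin n) ℚ) :
    dividedSymmetrization f =
      listSymm (fun m => evalRat n (listVal m) (rename (fun i : Fin n => (i.val : ℤ) + 1) f))
        (List.ofFn fun i => algebraMap (MvPolynomial (Fin n) ℚ)
          (FractionRing (MvPolynomial (Fin n) ℚ)) (X i)) := by
  rw [listSymm, ← sum_perm_ofFn, dividedSymmetrization]
  · refine Finset.sum_congr rfl fun w _ => ?_
    congr 1
    · have : (algebraMap (MvPolynomial (Fin n) ℚ) (FractionRing (MvPolynomial (Fin n) ℚ))).comp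
          (rename w : MvPolynomial (Fin n) ℚ →ₐ[ℚ] _).toRingHom =
          (evalRat n (listVal (List.ofFn ((fun i => algebraMap (MvPolynomial (Fin n) ℚ)
          (FractionRing (MvPolynomial (Fin n) ℚ)) (X i)) ∘ w)))).comp
          (rename (fun i : Fin n => (i.val : ℤ) + 1) :
            MvPolynomial (Fin n) ℚ →ₐ[ℚ] _).toRingHom := by
        refine ringHom_ext (fun r => ?_) fun i => ?_
        · simp only [AlgHom.toRingHom_eq_coe, RingHom.comp_apply, RingHom.coe_coe, rename_C,
            evalRat, eval₂Hom_C]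
        · simp [evalRat, listVal_succ]
      exact congrArg (fun φ => φ f) this
    · rw [consecDiff_eq_prod, List.length_ofFn, Finset.prod_range, dsDenominator, map_prod, map_prod]
      refine Finset.prod_congr rfl fun i _ => ?_
      have h1 : i.val < n := by omega
      have h2 : i.val + 1 < n := by omega
      simp [h1, h2]
  · exact (IsFractionRing.injective (MvPolynomial (Fin n) ℚ) _).comp (X_injective)

theorem slide_mem_range {n : ℕ} {W : Word} (hW : ∀ a ∈ W, a.val ≤ (n : ℤ)) :
    slide W ∈ (rename (fun i : Fin n => (i.val : ℤ) + 1) :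
      MvPolynomial (Fin n) ℚ →ₐ[ℚ] MvPolynomial ℤ ℚ).range := by
  refine Subalgebra.sum_mem _ fun a ha => Subalgebra.prod_mem _ fun j _ => ?_
  have h1 := ((mem_compatible W a).1 ha).1 j
  have h2 := hW _ (List.get_mem W j)
  refine ⟨X ⟨(a j - 1).toNat, by omega⟩, ?_⟩
  simp only [AlgHom.toRingHom_eq_coe, RingHom.coe_coe, rename_X]
  congr 1
  omega

theorem isHomogeneous_slide (W : Word) : (slide W).IsHomogeneous W.length := by
  refine IsHomogeneous.sum _ _ _ fun a _ => ?_
  simpa using IsHomogeneous.prod Finset.univ (fun j => (X (a j) : MvPolynomial ℤ ℚ)) (fun _ => 1)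
    fun j _ => isHomogeneous_X ℚ (a j)

end RationalFunctions

end Main

theorem mainTheorem4 (n : ℕ) (hn : 1 ≤ n) (A : Finset Word)
    (hinj : ∀ W ∈ A, W.IsInjective)
    (hlen : ∀ W ∈ A, W.length = n - 1)
    (hval : ∀ W ∈ A, ∀ a ∈ W, 1 ≤ a.val ∧ a.val ≤ (n : ℤ))
    (hstable : OmegaStable A) :
    ∃ f : MvPolynomial (Fin n) ℚ,
      MvPolynomial.rename (fun i : Fin n => (i.val : ℤ) + 1) f = ∑ W ∈ A, slide W ∧
      f.IsHomogeneous (n - 1) ∧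
      dividedSymmetrization f =
        (((A.filter IsOmegaParking).card : ℕ) : FractionRing (MvPolynomial (Fin n) ℚ)) := by
  classical
  obtain ⟨f, hf⟩ := Subalgebra.sum_mem (MvPolynomial.rename (fun i : Fin n => (i.val : ℤ) + 1) :
      MvPolynomial (Fin n) ℚ →ₐ[ℚ] MvPolynomial ℤ ℚ).range
    fun W hW => slide_mem_range fun a ha => (hval W hW a ha).2
  replace hf : MvPolynomial.rename (fun i : Fin n => (i.val : ℤ) + 1) f = ∑ W ∈ A, slide W := hf
  have hinj' : Function.Injective fun i : Fin n => (i.val : ℤ) + 1 := by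
    intro i j h
    exact Fin.ext (by simpa using h)
  refine ⟨f, hf, ?_, ?_⟩
  · rw [← MvPolynomial.IsHomogeneous.rename_isHomogeneous_iff hinj', hf]
    refine MvPolynomial.IsHomogeneous.sum _ _ _ fun W hW => ?_
    rw [← hlen W hW]
    exact isHomogeneous_slide W
  · have hcount : ∀ F ∈ A.image pSymbol, ForestWF F ∧ (forestLabels F).length = n - 1 ∧
        A.filter (fun W => pSymbol W = F) = forestWords F := by
      intro F hF
      obtain ⟨W, hW, rfl⟩ := Finset.mem_image.1 hF
      obtain ⟨h1, h2⟩ := pSymbol_wf (hinj W hW)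
      refine ⟨h1, h2.length_eq.trans (hlen W hW), ?_⟩
      ext W'
      rw [Finset.mem_filter, mem_forestWords h1]
      constructor
      · rintro ⟨h3, h4⟩
        exact ⟨hinj W' h3, h4⟩
      · rintro ⟨h3, h4⟩
        exact ⟨hstable W hW W' h3 h4.symm, h4⟩
    have hmaps : ∀ W ∈ A, pSymbol W ∈ A.image pSymbol := fun W hW => Finset.mem_image_of_mem _ hW
    have hsum : ∀ y : ℤ → FractionRing (MvPolynomial (Fin n) ℚ),
        evalRat n y (∑ W ∈ A, slide W) = ∑ F ∈ A.image pSymbol, forestSum y F.placed := by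
      intro y
      rw [map_sum, ← Finset.sum_fiberwise_of_maps_to hmaps]
      refine Finset.sum_congr rfl fun F hF => ?_
      obtain ⟨h1, -, h3⟩ := hcount F hF
      rw [h3, ← sum_forestWords_chainSum_eq_forestSum y h1 (toLex (0, 1))]
      refine Finset.sum_congr rfl fun W hW => ?_
      rw [slide_eq_chainSum ((mem_forestWords h1).1 hW).1 (toLex (0, 1)), map_chainSum]
      simp [evalRat]
    have hnd : (List.ofFn fun i => algebraMap (MvPolynomial (Fin n) ℚ)
        (FractionRing (MvPolynomial (Fin n) ℚ)) (MvPolynomial.X i)).Nodup :=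
      List.nodup_ofFn.2
        ((IsFractionRing.injective (MvPolynomial (Fin n) ℚ) _).comp MvPolynomial.X_injective)
    rw [dividedSymmetrization_eq_listSymm, hf]
    simp only [hsum]
    rw [listSymm_sum, Finset.card_filter, ← Finset.sum_fiberwise_of_maps_to hmaps, Nat.cast_sum]
    refine Finset.sum_congr rfl fun F hF => ?_
    obtain ⟨h1, h2, h3⟩ := hcount F hF
    rw [listSymm_forestSum_placed h1 h2 _ hnd (by rw [List.length_ofFn]; omega)]
    have hpark : ∀ W ∈ A.filter (fun W => pSymbol W = F), (IsOmegaParking W ↔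
        ∀ x, (∃ T ∈ F, x ∈ T.support) ↔ x ∈ Finset.Icc 1 ((n - 1 : ℕ) : ℤ)) := by
      intro W hW
      obtain ⟨hWA, rfl⟩ := Finset.mem_filter.1 hW
      rw [isOmegaParking_iff (hinj W hWA), hlen W hWA]
    rw [Finset.sum_congr rfl fun W hW => by rw [if_congr (hpark W hW) rfl rfl], h3]
    split_ifs <;> simp
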